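/- Let $X,Z$ be random variables on a probability space, with values in measurable spaces $\mathcal X,\mathcal Z$. Let $\mathcal H_{\mathcal X},\mathcal H_{\mathcal Z}$ be separable reproducing kernel Hilbert spaces of real functions on $\mathcal X$ and $\mathcal Z$, with kernels $k_{\mathcal X},k_{\mathcal Z}$ such that the maps $x\mapsto k_{\mathcal X}(x,\cdot)$ and $z\mapsto k_{\mathcal Z}(z,\cdot)$ are measurable and, for constants $B_{\mathcal X},B_{\mathcal Z}>0$, $\sup_x k_{\mathcal X}(x,x)\le B_{\mathcal X}^2$ and $\sup_z k_{\mathcal Z}(z,z)\le B_{\mathcal Z}^2$. Let $\mathcal G$ be the $\mathcal H_{\mathcal X}$-valued reproducing kernel Hilbert space on $\mathcal Z$ with operator-valued kernel $k_{\mathcal Z}(z,z')\,\mathrm{Id}$. Let $F_*:\mathcal Z\to\mathcal H_{\mathcal X}$ be measurable with $F_*(Z)=\mathbb E[k_{\mathcal X}(X,\cdot)\mid Z]$ almost surely, and put $\tilde{\mathcal E}(F)=\mathbb E\big[\|k_{\mathcal X}(X,\cdot)-F(Z)\|_{\mathcal H_{\mathcal X}}^2\big]$. Let $(X_i,Z_i)_{i\ge1}$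 be i.i.d. with the law of $(X,Z)$ and, for $n\ge1$ and $\lambda>0$, let $\hat F_{n,\lambda}\in\mathcal G$ be the (unique) minimiser over $F\in\mathcal G$ of $\frac1n\sum_{i=1}^n\|k_{\mathcal X}(X_i,\cdot)-F(Z_i)\|_{\mathcal H_{\mathcal X}}^2+\lambda\|F\|_{\mathcal G}^2$, that is, $$\hat F_{n,\lambda}=\sum_{i,j=1}^n k_{\mathcal Z}(Z_i,\cdot)\,W_{ij}\,k_{\mathcal X}(X_j,\cdot),\qquad W=\Big(\big(k_{\mathcal Z}(Z_i,Z_j)\big)_{i,j}+n\lambda I\Big)^{-1}.$$ Assume that $F_*\in\mathcal G$. 1. For all $n\ge1$, $\lambda>0$ and $\delta\in(0,1)$, with probability at least $1-\delta$, $$\tilde{\mathcal E}(\hat F_{n,\lambda})-\tilde{\mathcal E}(F_*)\le\lambda\|F_*\|_{\mathcal G}^2+\frac{2\ln(4/\delta)}{3n\lambda}\Big(1+\sqrt{1+\tfrac{18n}{\ln(4/\delta)}}\Big)\Big(\big(B_{\mathcal Z}\|F_*\|_{\mathcal G}+B_{\mathcal X}\big)^2\lambda+B_{\mathcal X}^2\big(B_{\mathcal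 Z}+\sqrt\lambda\big)^2\Big).$$ 2. If $\lambda_n>0$, $\lambda_n\to0$, $n^{-1/2}=o(\lambda_n)$ and $\lambda_n=O(n^{-1/4})$, then $\tilde{\mathcal E}(\hat F_{n,\lambda_n})-\tilde{\mathcal E}(F_*)=O_p(n^{-1/4})$. -/

import Mathlib

open MeasureTheory ProbabilityTheory Filter Topology

section Kernels

variable {S : Type*} (H : Type*) [NormedAddCommGroup H] [InnerProductSpace ℝ H] [CompleteSpace H]
  [RKHS ℝ H S ℝ]

/-- The point embedding `k(s, ·)` of `s`, as an element of the Hilbert space `H` of real functions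
with reproducing kernel `k`: for all `f : H`, `⟪k(s, ·), f⟫ = f s`. -/
noncomputable def pointEmbedding (s : S) : H := RKHS.kerFun H s (1 : ℝ)

/-- The real-valued reproducing kernel `k(s, t)` of the Hilbert space `H` of real functions. -/
noncomputable def scalarKernel (s t : S) : ℝ := RKHS.kernel H s t (1 : ℝ)

theorem inner_pointEmbedding (s : S) (f : H) : inner ℝ (pointEmbedding H s) f = f s := by
  simp [pointEmbedding]

theorem scalarKernel_eq_inner (s t : S) :
    scalarKernel H s t = inner ℝ (pointEmbedding H s) (pointEmbedding H t) := by
  rw [inner_pointEmbedding, pointEmbedding, RKHS.kerFun_apply, scalarKernel]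

end Kernels

section Learning

variable {𝒳 𝒵 HX : Type*} [NormedAddCommGroup HX] [InnerProductSpace ℝ HX]
  [CompleteSpace HX] [RKHS ℝ HX 𝒳 ℝ]

/-- `F` is a version of the regression function of the conditional mean embedding of `X` given `Z`:
`F` is measurable and `F ∘ Z = E[k_X(X, ·) | σ(Z)]` almost surely (a Bochner conditional
expectation in `HX`). -/
def IsConditionalMeanFunction {Ω : Type*} [MeasurableSpace Ω] [MeasurableSpace 𝒵]
    (P : Measure Ω) (X : Ω → 𝒳) (Z : Ω → 𝒵) (F : 𝒵 → HX) : Prop :=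
  StronglyMeasurable F ∧
    (fun ω => F (Z ω)) =ᵐ[P]
      P[fun ω => pointEmbedding HX (X ω) | MeasurableSpace.comap Z inferInstance]

/-- The surrogate risk `E[‖k_X(X, ·) - F(Z)‖²]`. -/
noncomputable def surrogateRisk {Ω : Type*} [MeasurableSpace Ω] (P : Measure Ω) (X : Ω → 𝒳) (Z : Ω → 𝒵)
    (F : 𝒵 → HX) : ℝ :=
  ∫ ω, ‖pointEmbedding HX (X ω) - F (Z ω)‖ ^ 2 ∂P

variable (HZ : Type*) [NormedAddCommGroup HZ] [InnerProductSpace ℝ HZ] [CompleteSpace HZ]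
  [RKHS ℝ HZ 𝒵 ℝ]
  (G : Type*) [NormedAddCommGroup G] [InnerProductSpace ℝ G] [CompleteSpace G] [RKHS ℝ G 𝒵 HX]

/-- The `HX`-valued reproducing kernel Hilbert space `G` on `𝒵` has the operator-valued kernel
`l(z, z') = k_Z(z, z') Id`, where `k_Z` is the reproducing kernel of `HZ`. -/
def HasScalarTypeKernel : Prop :=
  ∀ z z' : 𝒵, RKHS.kernel G z z' = scalarKernel HZ z z' • ContinuousLinearMap.id ℝ HX

variable {G} in
/-- The regularised empirical risk `(1/n) ∑ᵢ ‖k_X(xᵢ, ·) - F(zᵢ)‖² + lam ‖F‖²` of `F` in `G`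
for the data `D = ((x₁, z₁), …, (xₙ, zₙ))`. -/
noncomputable def regularizedEmpiricalRisk {n : ℕ} (lam : ℝ) (D : Fin n → 𝒳 × 𝒵) (F : G) : ℝ :=
  (1 / (n : ℝ)) * ∑ i, ‖pointEmbedding HX (D i).1 - F (D i).2‖ ^ 2 + lam * ‖F‖ ^ 2

/-- The matrix `K_Z + n lam I`, where `K_Z` is the Gram matrix of `z₁, …, zₙ`. -/
noncomputable def regularizedGram {n : ℕ} (lam : ℝ) (D : Fin n → 𝒳 × 𝒵) :
    Matrix (Fin n) (Fin n) ℝ :=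
  Matrix.of (fun i j => scalarKernel HZ (D i).2 (D j).2) + ((n : ℝ) * lam) • 1

/-- The estimator `∑ᵢ k_Z(zᵢ, ·) fᵢ` in `G`, with coefficients `fᵢ = ∑ⱼ Wᵢⱼ k_X(xⱼ, ·)`, where
`W = (K_Z + n lam I)⁻¹`. It is the unique minimiser over `G` of the regularised empirical risk
(proved in `regularizedEmpiricalRisk_cmeEstimator_lt`). -/
noncomputable def cmeEstimator {n : ℕ} (lam : ℝ) (D : Fin n → 𝒳 × 𝒵) : G :=
  ∑ i, RKHS.kerFun G (D i).2 (∑ j, (regularizedGram HZ lam D)⁻¹ i j • pointEmbedding HX (D j).1)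

theorem isUnit_det_regularizedGram {n : ℕ} (hn : 1 ≤ n) {lam : ℝ} (hlam : 0 < lam)
    (D : Fin n → 𝒳 × 𝒵) : IsUnit (regularizedGram HZ lam D).det := by
  have hn' : (0 : ℝ) < n := by exact_mod_cast hn
  have h1 : (Matrix.of (fun i j => scalarKernel HZ (D i).2 (D j).2)).PosSemidef := by
    have : Matrix.of (fun i j => scalarKernel HZ (D i).2 (D j).2)
        = Matrix.gram ℝ (fun i => pointEmbedding HZ (D i).2) := by
      ext i j
      simp [Matrix.gram, scalarKernel_eq_inner]
    rw [this]
    exact Matrix.posSemidef_gram ℝ _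
  have h2 : (((n : ℝ) * lam) • (1 : Matrix (Fin n) (Fin n) ℝ)).PosDef :=
    Matrix.PosDef.one.smul (by positivity)
  have h3 : (regularizedGram HZ lam D).PosDef := Matrix.PosDef.posSemidef_add h1 h2
  exact isUnit_iff_ne_zero.mpr h3.det_pos.ne'

/-- The estimator is the unique minimiser of the regularised empirical risk. -/
theorem regularizedEmpiricalRisk_cmeEstimator_lt (hG : HasScalarTypeKernel HZ G) {n : ℕ}
    (hn : 1 ≤ n) {lam : ℝ} (hlam : 0 < lam) (D : Fin n → 𝒳 × 𝒵) (F : G)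
    (hF : F ≠ cmeEstimator HZ G lam D) :
    regularizedEmpiricalRisk lam D (cmeEstimator HZ G lam D) < regularizedEmpiricalRisk lam D F := by
  have hn' : (0 : ℝ) < n := by exact_mod_cast hn
  set Fh := cmeEstimator HZ G lam D with hFh
  set u : Fin n → HX := fun i =>
    ∑ j, (regularizedGram HZ lam D)⁻¹ i j • pointEmbedding HX (D j).1 with hu
  -- the linear system solved by the coefficients
  have hsys : ∀ i, ∑ l, regularizedGram HZ lam D i l • u l = pointEmbedding HX (D i).1 := by
    intro i
    have hmul := Matrix.mul_nonsing_inv _ (isUnit_det_regularizedGram HZ hn hlam D)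
    calc ∑ l, regularizedGram HZ lam D i l • u l
        = ∑ j, (∑ l, regularizedGram HZ lam D i l * (regularizedGram HZ lam D)⁻¹ l j)
            • pointEmbedding HX (D j).1 := by
          simp only [hu, Finset.smul_sum, Finset.sum_smul, smul_smul]
          exact Finset.sum_comm
      _ = ∑ j, (1 : Matrix (Fin n) (Fin n) ℝ) i j • pointEmbedding HX (D j).1 := by
          refine Finset.sum_congr rfl fun j _ => ?_
          rw [← hmul, Matrix.mul_apply]
      _ = _ := by simp [Matrix.one_apply]
  have hev : ∀ i, Fh (D i).2 = ∑ l, scalarKernel HZ (D i).2 (D l).2 • u l := by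
    intro i
    have : Fh (D i).2 = (RKHS.kerFun G (D i).2).adjoint Fh := by simp
    rw [this, hFh, cmeEstimator, map_sum]
    refine Finset.sum_congr rfl fun l _ => ?_
    rw [RKHS.adjoint_kerFun, RKHS.kerFun_apply, hG]
    rfl
  have hres : ∀ i, pointEmbedding HX (D i).1 - Fh (D i).2 = ((n : ℝ) * lam) • u i := by
    intro i
    rw [← hsys i, hev i, ← Finset.sum_sub_distrib]
    simp [regularizedGram, add_smul, Matrix.one_apply]
  obtain ⟨d, rfl⟩ : ∃ d, F = Fh + d := ⟨F - Fh, by abel⟩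
  have hd : d ≠ 0 := by
    rintro rfl
    exact hF (by simp)
  have hin : inner ℝ Fh d = ∑ i, inner ℝ (u i) (d (D i).2) := by
    rw [hFh, cmeEstimator, sum_inner]
    refine Finset.sum_congr rfl fun i _ => ?_
    rw [RKHS.kerFun_inner]
  have hterm : ∀ i, ‖pointEmbedding HX (D i).1 - (Fh + d) (D i).2‖ ^ 2
      = ‖pointEmbedding HX (D i).1 - Fh (D i).2‖ ^ 2
        - 2 * ((n : ℝ) * lam) * inner ℝ (u i) (d (D i).2) + ‖d (D i).2‖ ^ 2 := by
    intro i
    have : pointEmbedding HX (D i).1 - (Fh + d) (D i).2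
        = (pointEmbedding HX (D i).1 - Fh (D i).2) - d (D i).2 := by
      rw [RKHS.coe_add, Pi.add_apply]; abel
    rw [this, norm_sub_sq_real, hres i, inner_smul_left]
    simp only [conj_trivial]
    ring
  have hkey : regularizedEmpiricalRisk lam D (Fh + d) = regularizedEmpiricalRisk lam D Fh
      + ((1 / (n : ℝ)) * ∑ i, ‖d (D i).2‖ ^ 2 + lam * ‖d‖ ^ 2) := by
    unfold regularizedEmpiricalRisk
    simp only [hterm, Finset.sum_add_distrib, Finset.sum_sub_distrib, ← Finset.mul_sum, ← hin]
    rw [norm_add_sq_real]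
    field_simp
    ring
  rw [hkey]
  have h1 : 0 < ‖d‖ := norm_pos_iff.mpr hd
  have h2 : 0 ≤ ∑ i, ‖d (D i).2‖ ^ 2 := Finset.sum_nonneg fun i _ => by positivity
  have h3 : 0 < (1 / (n : ℝ)) * ∑ i, ‖d (D i).2‖ ^ 2 + lam * ‖d‖ ^ 2 := by positivity
  linarith

end Learning

/-- `Y n = O_p(a n)`: for every `ε > 0` there are `M` and `N` such that
`Q(|Y n| > M * a n) ≤ ε` for all `n ≥ N`. -/
def IsBigOInProbability {Ω' : Type*} [MeasurableSpace Ω'] (Q : Measure Ω') (Y : ℕ → Ω' → ℝ)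
    (a : ℕ → ℝ) : Prop :=
  ∀ ε : ℝ, 0 < ε → ∃ M : ℝ, ∀ᶠ n in atTop, Q {ω | M * a n < |Y n ω|} ≤ ENNReal.ofReal ε

/-! Because the kernel of `G` is `k_Z Id`, finite combinations of kernel functions embed
isometrically in the Hilbert tensor product of `HZ` and `HX`, with `⟪F z, v⟫ = ⟪V, k_z ⊗ v⟫` for the
tensor `V` of `F`. Moreover `‖F z‖² = ⟪T, k_z ⊗ k_z⟫` for some `T` with `‖T‖ ≤ ‖F‖²`. The loss at a
point is therefore affine in the fixed vectors `‖k_x‖²`, `k_z ⊗ k_x`, `k_z ⊗ k_z`, and the gap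
between empirical and true risk is controlled, uniformly on balls of `G`, by the deviations of three
empirical means. Each of these obeys a dimension-free Hoeffding bound
(`measure_pi_norm_mean_sub_integral_gt_le`).

The finite sample bound compares the regularised empirical risks of the estimator and of `F`.
Comparison with `0` gives the norm bound `BX / √lam`; uniform control handles the random estimator,
and a fourth deviation handles the fixed `F`. The sub-Gaussian error is smaller than the
Bernstein-type expression in the statement.

That bound has a term of order `1 / (√n lam)`, which is `O(n^(-1/4))` only if `lam` is not much
smaller than `n^(-1/4)`. The rate needs a localised argument. The excess risk is the squared `L²`
norm of `d`, the estimator minus `F`. Minimality gives `q_n(d) + lam ‖d‖² ≤ 2⟪η, d⟫ - 2 lam ⟪F, d⟫`,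
where `q_n` is the empirical second moment and `η` a centred empirical mean of size `n^(-1/2)`. Once
the second moment form deviates by at most `lam`, the regulariser absorbs the passage from `q_n` to
the population, and the excess risk is at most `4 (‖η‖ + lam ‖F‖)² / lam`, of order `n^(-1/2) +
lam`. -/

/-! ### Hoeffding-type concentration in a Hilbert space. -/

section Concentration

variable {S E : Type*} [MeasurableSpace S] {μ : Measure S} [IsProbabilityMeasure μ]
  [NormedAddCommGroup E]

theorem integrable_of_stronglyMeasurable_of_norm_le {α : Type*} [MeasurableSpace α]
    {ν : Measure α} [IsFiniteMeasure ν] {f : α → E} (hf : StronglyMeasurable f) {C : ℝ}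
    (hC : ∀ x, ‖f x‖ ≤ C) : Integrable f ν :=
  Integrable.of_bound hf.aestronglyMeasurable C (ae_of_all _ hC)

theorem integral_pi_fin_succ [NormedSpace ℝ E] {n : ℕ} {f : (Fin (n + 1) → S) → E}
    (hf : Integrable f (Measure.pi fun _ => μ)) :
    ∫ x, f x ∂Measure.pi (fun _ => μ)
      = ∫ y, ∫ s, f (Fin.cons s y) ∂μ ∂Measure.pi (fun _ : Fin n => μ) := by
  have hmp := (measurePreserving_piFinSuccAbove (fun _ : Fin (n + 1) => μ) 0).symm
  have h1 := hmp.integral_comp (MeasurableEquiv.measurableEmbedding _) f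
  have h2 : Integrable (fun p => f ((MeasurableEquiv.piFinSuccAbove (fun _ => S) 0).symm p))
      (μ.prod (Measure.pi fun _ : Fin n => μ)) :=
    (hmp.integrable_comp_emb (MeasurableEquiv.measurableEmbedding _)).2 hf
  rw [← h1]
  refine (integral_prod_symm _ h2).trans ?_
  simp only [MeasurableEquiv.piFinSuccAbove_symm_apply, Fin.insertNthEquiv_zero]
  rfl

theorem stronglyMeasurable_sum_eval {ξ : S → E} (hξ : StronglyMeasurable ξ) (n : ℕ) :
    StronglyMeasurable fun x : Fin n → S => ∑ i, ξ (x i) :=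
  Finset.stronglyMeasurable_fun_sum _ fun i _ => hξ.comp_measurable (measurable_pi_apply i)

theorem norm_sum_eval_le {T : Type*} {ξ : T → E} {M : ℝ} (hM : ∀ s, ‖ξ s‖ ≤ M) {n : ℕ}
    (x : Fin n → T) :
    ‖∑ i, ξ (x i)‖ ≤ n * M := by
  simpa using norm_sum_le_of_le Finset.univ fun i _ => hM (x i)

theorem LipschitzWith.abs_le_add_norm {g : E → ℝ} (hg : LipschitzWith 1 g) (y : E) :
    |g y| ≤ |g 0| + ‖y‖ := by
  have h := hg.dist_le_mul y 0
  simp only [NNReal.coe_one, one_mul, Real.dist_eq, dist_zero_right] at h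
  have := abs_sub_abs_le_abs_sub (g y) (g 0)
  linarith

theorem integrable_lipschitz_sum_eval {ξ : S → E} (hξ : StronglyMeasurable ξ) {M : ℝ}
    (hM : ∀ s, ‖ξ s‖ ≤ M) {g : E → ℝ} (hg : LipschitzWith 1 g) (n : ℕ) :
    Integrable (fun x : Fin n → S => g (∑ i, ξ (x i))) (Measure.pi fun _ => μ) :=
  integrable_of_stronglyMeasurable_of_norm_le
    (hg.continuous.comp_stronglyMeasurable (stronglyMeasurable_sum_eval hξ n))
    (C := |g 0| + n * M)
    fun x => (hg.abs_le_add_norm _).trans (by gcongr; exact norm_sum_eval_le hM x)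

theorem integrable_exp_lipschitz_sum_eval {ξ : S → E} (hξ : StronglyMeasurable ξ) {M : ℝ}
    (hM : ∀ s, ‖ξ s‖ ≤ M) {g : E → ℝ} (hg : LipschitzWith 1 g) (c : ℝ) (n : ℕ) :
    Integrable (fun x : Fin n → S => Real.exp (c * g (∑ i, ξ (x i)))) (Measure.pi fun _ => μ) := by
  refine integrable_of_stronglyMeasurable_of_norm_le
    (C := Real.exp (|c| * (|g 0| + n * M))) ?_ fun x => ?_
  · exact Real.continuous_exp.comp_stronglyMeasurable
      ((hg.continuous.comp_stronglyMeasurable (stronglyMeasurable_sum_eval hξ n)).const_mul c)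
  · rw [Real.norm_eq_abs, Real.abs_exp, Real.exp_le_exp]
    refine (le_abs_self _).trans ?_
    rw [abs_mul]
    gcongr
    exact (hg.abs_le_add_norm _).trans (by gcongr; exact norm_sum_eval_le hM x)

theorem lipschitzWith_integral_add {ξ : S → E} (hξ : StronglyMeasurable ξ) {M : ℝ}
    (hM : ∀ s, ‖ξ s‖ ≤ M) {g : E → ℝ} (hg : LipschitzWith 1 g) :
    LipschitzWith 1 fun y => ∫ s, g (ξ s + y) ∂μ := by
  have hint : ∀ y, Integrable (fun s => g (ξ s + y)) μ := fun y =>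
    integrable_of_stronglyMeasurable_of_norm_le
      (hg.continuous.comp_stronglyMeasurable (hξ.add_const y)) (C := |g 0| + (M + ‖y‖))
      fun s => (hg.abs_le_add_norm _).trans (by gcongr; exact (norm_add_le _ _).trans (by
        gcongr; exact hM s))
  refine LipschitzWith.of_dist_le_mul fun y z => ?_
  rw [Real.dist_eq, ← integral_sub (hint y) (hint z)]
  have h : ∀ s, ‖g (ξ s + y) - g (ξ s + z)‖ ≤ dist y z := fun s => by
    have := hg.dist_le_mul (ξ s + y) (ξ s + z)
    simpa [Real.dist_eq] using this
  simpa using norm_integral_le_of_norm_le_const (μ := μ) (ae_of_all _ h)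

/-- The exponential moments of a `1`-Lipschitz function of a sum of i.i.d. bounded vectors. -/
theorem integral_exp_lipschitz_sum_le {ξ : S → E} (hξ : StronglyMeasurable ξ) {M : ℝ}
    (hM : ∀ s, ‖ξ s‖ ≤ M) (c : ℝ) (n : ℕ) {g : E → ℝ} (hg : LipschitzWith 1 g) :
    ∫ x : Fin n → S, Real.exp (c * g (∑ i, ξ (x i))) ∂Measure.pi (fun _ => μ)
      ≤ Real.exp (c * ∫ x : Fin n → S, g (∑ i, ξ (x i)) ∂Measure.pi (fun _ => μ)
        + n * (M ^ 2 * c ^ 2 / 2)) := by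
  induction n generalizing g with
  | zero => simp
  | succ n ih =>
    -- Integrating out one coordinate replaces `g` by `h`, again `1`-Lipschitz; hence the induction
    -- over all such `g`.
    set h : E → ℝ := fun y => ∫ s, g (ξ s + y) ∂μ with hh
    have hlip : LipschitzWith 1 h := lipschitzWith_integral_add hξ hM hg
    rw [integral_pi_fin_succ (integrable_exp_lipschitz_sum_eval hξ hM hg c _),
      integral_pi_fin_succ (integrable_lipschitz_sum_eval hξ hM hg _)]
    simp only [Fin.sum_univ_succ, Fin.cons_zero, Fin.cons_succ]
    have hstep : ∀ y : E, ∫ s, Real.exp (c * g (ξ s + y)) ∂μ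
        ≤ Real.exp (c * h y) * Real.exp (M ^ 2 * c ^ 2 / 2) := by
      intro y
      have hsm : StronglyMeasurable fun s => g (ξ s + y) :=
        hg.continuous.comp_stronglyMeasurable (hξ.add_const y)
      -- The interval is centred at `g y` and has length `2 * M` even if `ξ` is not centred, so
      -- Hoeffding's lemma gives variance proxy `M ^ 2`.
      have hmem : ∀ s, g (ξ s + y) ∈ Set.Icc (g y - M) (g y + M) := fun s => by
        have h1 := hg.dist_le_mul (ξ s + y) y
        simp only [NNReal.coe_one, one_mul, dist_eq_norm, add_sub_cancel_right] at h1
        have h2 := abs_le.1 (h1.trans (hM s))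
        constructor <;> linarith [h2.1, h2.2]
      have hsub := (hasSubgaussianMGF_of_mem_Icc (μ := μ) hsm.measurable.aemeasurable
        (ae_of_all _ hmem)).mgf_le c
      have hconst : (((‖g y + M - (g y - M)‖₊ / 2) ^ 2 : NNReal) : ℝ) = M ^ 2 := by
        have : g y + M - (g y - M) = 2 * M := by ring
        rw [this]
        simp
      rw [hconst] at hsub
      have : ∫ s, Real.exp (c * g (ξ s + y)) ∂μ
          = Real.exp (c * h y) * mgf (fun s => g (ξ s + y) - ∫ s, g (ξ s + y) ∂μ) μ c := by
        rw [mgf, ← integral_const_mul]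
        refine integral_congr_ae (ae_of_all _ fun s => ?_)
        simp only [hh]
        rw [← Real.exp_add]
        congr 1
        ring
      rw [this]
      gcongr
    calc ∫ x : Fin n → S, ∫ s, Real.exp (c * g (ξ s + ∑ i, ξ (x i))) ∂μ ∂Measure.pi (fun _ => μ)
        ≤ ∫ x : Fin n → S, Real.exp (c * h (∑ i, ξ (x i))) * Real.exp (M ^ 2 * c ^ 2 / 2)
            ∂Measure.pi (fun _ => μ) :=
          integral_mono_of_nonneg
            (ae_of_all _ fun x => integral_nonneg fun s => (Real.exp_pos _).le)
            ((integrable_exp_lipschitz_sum_eval hξ hM hlip c n).mul_const _)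
            (ae_of_all _ fun x => hstep _)
      _ ≤ Real.exp (c * ∫ x : Fin n → S, h (∑ i, ξ (x i)) ∂Measure.pi (fun _ => μ)
            + n * (M ^ 2 * c ^ 2 / 2)) * Real.exp (M ^ 2 * c ^ 2 / 2) := by
          rw [integral_mul_const]
          gcongr
          exact ih hlip
      _ = _ := by
          rw [← Real.exp_add]
          congr 1
          push_cast
          ring

variable [InnerProductSpace ℝ E] [CompleteSpace E]

/-- Integrating the newest centred coordinate kills its cross term with the others. -/
theorem integral_norm_sq_sum_eval_of_integral_eq_zero {ξ : S → E} (hξ : StronglyMeasurable ξ)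
    {M : ℝ} (hM : ∀ s, ‖ξ s‖ ≤ M) (h0 : ∫ s, ξ s ∂μ = 0) (n : ℕ) :
    ∫ x : Fin n → S, ‖∑ i, ξ (x i)‖ ^ 2 ∂Measure.pi (fun _ => μ) = n * ∫ s, ‖ξ s‖ ^ 2 ∂μ := by
  have hint : ∀ n, Integrable (fun x : Fin n → S => ‖∑ i, ξ (x i)‖ ^ 2)
      (Measure.pi fun _ => μ) := fun n =>
    integrable_of_stronglyMeasurable_of_norm_le (C := (n * M) ^ 2)
      ((stronglyMeasurable_sum_eval hξ n).norm.pow 2) fun x => by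
        rw [norm_pow, norm_norm]
        gcongr
        exact norm_sum_eval_le hM x
  have hξi : Integrable ξ μ := integrable_of_stronglyMeasurable_of_norm_le hξ hM
  have hξ2 : Integrable (fun s => ‖ξ s‖ ^ 2) μ :=
    integrable_of_stronglyMeasurable_of_norm_le (C := M ^ 2) (hξ.norm.pow 2) fun s => by
      rw [norm_pow, norm_norm]
      gcongr
      exact hM s
  induction n with
  | zero => simp
  | succ n ih =>
    rw [integral_pi_fin_succ (hint _)]
    simp only [Fin.sum_univ_succ, Fin.cons_zero, Fin.cons_succ]
    have hin : ∀ y : E, ∫ s, ‖ξ s + y‖ ^ 2 ∂μ = ∫ s, ‖ξ s‖ ^ 2 ∂μ + ‖y‖ ^ 2 := by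
      intro y
      have h1 : ∫ s, inner ℝ y (ξ s) ∂μ = 0 := by
        rw [integral_inner hξi, h0, inner_zero_right]
      have hi1 : Integrable (fun s => inner ℝ y (ξ s)) μ := hξi.const_inner y
      have : ∀ s, ‖ξ s + y‖ ^ 2 = ‖ξ s‖ ^ 2 + 2 * inner ℝ y (ξ s) + ‖y‖ ^ 2 := fun s => by
        rw [norm_add_sq_real, real_inner_comm]
      simp only [this]
      rw [integral_add (hξ2.fun_add (hi1.const_mul 2)) (integrable_const _),
        integral_add hξ2 (hi1.const_mul 2), integral_const_mul, h1]
      simp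
    simp only [hin]
    rw [integral_add (integrable_const _) (hint n), ih]
    simp
    ring

/-- Jensen reduces to the second moment, which is additive. Centring only decreases `∫ ‖ξ‖²`, so `M`
suffices although the centred vectors may have norm up to `2 * M`. -/
theorem integral_norm_sum_sub_le {ξ : S → E} (hξ : StronglyMeasurable ξ) {M : ℝ}
    (hM : ∀ s, ‖ξ s‖ ≤ M) (n : ℕ) :
    ∫ x : Fin n → S, ‖∑ i, ξ (x i) - (n : ℝ) • ∫ s, ξ s ∂μ‖ ∂Measure.pi (fun _ => μ)
      ≤ √n * M := by
  obtain ⟨s₀⟩ : Nonempty S := μ.nonempty_of_neZero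
  have hM0 : 0 ≤ M := (norm_nonneg _).trans (hM s₀)
  set m := ∫ s, ξ s ∂μ with hm
  have hξi : Integrable ξ μ := integrable_of_stronglyMeasurable_of_norm_le hξ hM
  have hξ2 : Integrable (fun s => ‖ξ s‖ ^ 2) μ :=
    integrable_of_stronglyMeasurable_of_norm_le (C := M ^ 2) (hξ.norm.pow 2) fun s => by
      rw [norm_pow, norm_norm]
      gcongr
      exact hM s
  have hζ : StronglyMeasurable fun s => ξ s - m := hξ.sub stronglyMeasurable_const
  have hζM : ∀ s, ‖ξ s - m‖ ≤ M + ‖m‖ := fun s => (norm_sub_le _ _).trans (by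
    gcongr; exact hM s)
  have hζ0 : ∫ s, (ξ s - m) ∂μ = 0 := by
    rw [integral_sub hξi (integrable_const _)]
    simp [hm]
  have hvar : ∫ s, ‖ξ s - m‖ ^ 2 ∂μ ≤ M ^ 2 := by
    have h1 : ∀ s, ‖ξ s - m‖ ^ 2 = ‖ξ s‖ ^ 2 - 2 * inner ℝ m (ξ s) + ‖m‖ ^ 2 := fun s => by
      rw [norm_sub_sq_real, real_inner_comm]
    have hi1 : Integrable (fun s => inner ℝ m (ξ s)) μ := hξi.const_inner m
    have hi2 : Integrable (fun s => ‖ξ s‖ ^ 2 - 2 * inner ℝ m (ξ s)) μ := hξ2.sub (hi1.const_mul 2)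
    simp only [h1]
    rw [integral_add hi2 (integrable_const _),
      integral_sub hξ2 (hi1.const_mul 2), integral_const_mul, integral_inner hξi, ← hm,
      real_inner_self_eq_norm_sq]
    have h2 : ∫ s, ‖ξ s‖ ^ 2 ∂μ ≤ M ^ 2 := by
      have := integral_mono hξ2 (integrable_const (M ^ 2)) fun s => by
        have := hM s
        show ‖ξ s‖ ^ 2 ≤ M ^ 2
        gcongr
      simpa using this
    simp
    nlinarith [sq_nonneg ‖m‖]
  have hsum : ∀ x : Fin n → S, ∑ i, ξ (x i) - (n : ℝ) • m = ∑ i, (ξ (x i) - m) := fun x => by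
    simp [Finset.sum_sub_distrib, Nat.cast_smul_eq_nsmul]
  simp only [hsum]
  set Y : (Fin n → S) → ℝ := fun x => ‖∑ i, (ξ (x i) - m)‖ with hY
  have hYm : StronglyMeasurable Y := (stronglyMeasurable_sum_eval hζ n).norm
  have hYi : Integrable Y (Measure.pi fun _ => μ) :=
    integrable_of_stronglyMeasurable_of_norm_le (C := n * (M + ‖m‖)) hYm fun x => by
      rw [hY, norm_norm]
      exact norm_sum_eval_le hζM x
  have hY2 : ∫ x, Y x ^ 2 ∂Measure.pi (fun _ => μ) ≤ n * M ^ 2 := by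
    rw [integral_norm_sq_sum_eval_of_integral_eq_zero hζ hζM hζ0 n]
    gcongr
  have hY2i : Integrable (fun x => Y x ^ 2) (Measure.pi fun _ => μ) :=
    integrable_of_stronglyMeasurable_of_norm_le (C := (n * (M + ‖m‖)) ^ 2) (hYm.pow 2) fun x => by
      rw [hY, norm_pow, norm_norm]
      gcongr
      exact norm_sum_eval_le hζM x
  -- Nonnegativity of the variance of `Y`.
  have hjensen : (∫ x, Y x ∂Measure.pi (fun _ => μ)) ^ 2
      ≤ ∫ x, Y x ^ 2 ∂Measure.pi (fun _ => μ) := by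
    set a := ∫ x, Y x ∂Measure.pi (fun _ => μ) with ha
    have h1 : 0 ≤ ∫ x, (Y x - a) ^ 2 ∂Measure.pi (fun _ => μ) :=
      integral_nonneg fun x => sq_nonneg _
    have h2 : ∀ x, (Y x - a) ^ 2 = Y x ^ 2 - 2 * a * Y x + a ^ 2 := fun x => by ring
    have hi2 : Integrable (fun x => Y x ^ 2 - 2 * a * Y x) (Measure.pi fun _ => μ) :=
      hY2i.sub (hYi.const_mul _)
    simp only [h2] at h1
    rw [integral_add hi2 (integrable_const _),
      integral_sub hY2i (hYi.const_mul _), integral_const_mul, ← ha] at h1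
    simp at h1
    nlinarith
  refine le_of_sq_le_sq ?_ (by positivity)
  rw [mul_pow, Real.sq_sqrt (Nat.cast_nonneg n)]
  exact hjensen.trans hY2

/-- Concentration of the empirical mean of bounded i.i.d. vectors in a Hilbert space. -/
theorem measure_pi_norm_mean_sub_integral_gt_le {ξ : S → E} (hξ : StronglyMeasurable ξ) {M : ℝ}
    (hM0 : 0 < M) (hM : ∀ s, ‖ξ s‖ ≤ M) {n : ℕ} (hn : 1 ≤ n) {τ : ℝ} (hτ : 0 ≤ τ) :
    Measure.pi (fun _ : Fin n => μ)
      {x | M * ((1 + √(2 * τ)) / √n) < ‖(1 / (n : ℝ)) • ∑ i, ξ (x i) - ∫ s, ξ s ∂μ‖}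
      ≤ ENNReal.ofReal (Real.exp (-τ)) := by
  have hn' : (0 : ℝ) < n := by exact_mod_cast hn
  set m := ∫ s, ξ s ∂μ with hm
  set g : E → ℝ := fun y => ‖y - (n : ℝ) • m‖ with hg
  have hlip : LipschitzWith 1 g := by
    refine LipschitzWith.of_dist_le_mul fun y z => ?_
    rw [Real.dist_eq, NNReal.coe_one, one_mul, dist_eq_norm]
    simpa [hg] using abs_norm_sub_norm_le (y - (n : ℝ) • m) (z - (n : ℝ) • m)
  set ν := Measure.pi (fun _ : Fin n => μ) with hν
  -- The deviation `t` solves `t ^ 2 / (2 * n * M ^ 2) = τ`, and `c = t / (n * M ^ 2)` is the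
  -- optimal Chernoff parameter.
  set t := M * √(2 * τ * n) with ht
  set c := √(2 * τ / n) / M with hc
  have hsub : {x : Fin n → S | M * ((1 + √(2 * τ)) / √n) < ‖(1 / (n : ℝ)) • ∑ i, ξ (x i) - m‖}
      ⊆ {x | √n * M + t ≤ g (∑ i, ξ (x i))} := by
    intro x hx
    have h1 : (1 / (n : ℝ)) • ∑ i, ξ (x i) - m = (1 / (n : ℝ)) • (∑ i, ξ (x i) - (n : ℝ) • m) := by
      rw [smul_sub, smul_smul]
      simp [hn'.ne']
    have hx' : M * ((1 + √(2 * τ)) / √n) < ‖(1 / (n : ℝ)) • ∑ i, ξ (x i) - m‖ := hx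
    rw [h1, norm_smul, Real.norm_of_nonneg (by positivity), one_div, inv_mul_eq_div,
      lt_div_iff₀ hn'] at hx'
    refine le_of_eq_of_le ?_ hx'.le
    rw [ht, Real.sqrt_mul (by positivity)]
    have : (n : ℝ) = √n * √n := (Real.mul_self_sqrt hn'.le).symm
    have hs : √(n : ℝ) ≠ 0 := (Real.sqrt_pos.2 hn').ne'
    field_simp
    rw [Real.sq_sqrt hn'.le]
  have hsm : StronglyMeasurable fun x : Fin n → S => g (∑ i, ξ (x i)) :=
    hlip.continuous.comp_stronglyMeasurable (stronglyMeasurable_sum_eval hξ n)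
  have hchern := measure_ge_le_exp_mul_mgf (μ := ν) (X := fun x => g (∑ i, ξ (x i)))
    (√n * M + t) (t := c) (by positivity) (integrable_exp_lipschitz_sum_eval hξ hM hlip c n)
  have hmgf : mgf (fun x => g (∑ i, ξ (x i))) ν c
      ≤ Real.exp (c * (√n * M) + n * (M ^ 2 * c ^ 2 / 2)) := by
    refine (integral_exp_lipschitz_sum_le hξ hM c n hlip).trans ?_
    have hc0 : 0 ≤ c := by positivity
    gcongr
    exact integral_norm_sum_sub_le hξ hM n
  have hfin : ν.real {x | √n * M + t ≤ g (∑ i, ξ (x i))} ≤ Real.exp (-τ) := by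
    refine hchern.trans ((mul_le_mul_of_nonneg_left hmgf (Real.exp_pos _).le).trans ?_)
    rw [← Real.exp_add, Real.exp_le_exp]
    have hct : c * t = 2 * τ := by
      rw [hc, ht, div_mul_eq_mul_div, mul_left_comm, mul_div_cancel_left₀ _ hM0.ne',
        ← Real.sqrt_mul (by positivity)]
      have : 2 * τ / n * (2 * τ * n) = (2 * τ) ^ 2 := by field_simp
      rw [this, Real.sqrt_sq (by positivity)]
    have hc2 : n * (M ^ 2 * c ^ 2 / 2) = τ := by
      rw [hc, div_pow, Real.sq_sqrt (by positivity)]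
      field_simp
    rw [hc2]
    linarith
  calc ν _ ≤ ν {x | √n * M + t ≤ g (∑ i, ξ (x i))} := measure_mono hsub
    _ ≤ _ := by
      rw [← ENNReal.ofReal_toReal (measure_ne_top ν _)]
      exact ENNReal.ofReal_le_ofReal hfin

end Concentration

/-! ### Tensors as Hilbert-Schmidt operators. -/

section HilbertTensor

open scoped TensorProduct

variable {A B : Type*} [NormedAddCommGroup A] [InnerProductSpace ℝ A]
  [NormedAddCommGroup B] [InnerProductSpace ℝ B]

/-- The pure tensor `a ⊗ b` in the Hilbert space tensor product. -/
noncomputable def hilbertTmul (a : A) (b : B) : UniformSpace.Completion (A ⊗[ℝ] B) :=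
  ((a ⊗ₜ[ℝ] b : A ⊗[ℝ] B) : UniformSpace.Completion (A ⊗[ℝ] B))

theorem inner_hilbertTmul (a a' : A) (b b' : B) :
    inner ℝ (hilbertTmul a b) (hilbertTmul a' b') = inner ℝ a a' * inner ℝ b b' := by
  rw [hilbertTmul, hilbertTmul, UniformSpace.Completion.inner_coe, TensorProduct.inner_tmul]

theorem norm_hilbertTmul (a : A) (b : B) : ‖hilbertTmul a b‖ = ‖a‖ * ‖b‖ := by
  rw [hilbertTmul, UniformSpace.Completion.norm_coe, TensorProduct.norm_tmul]

theorem continuous_hilbertTmul : Continuous fun p : A × B => hilbertTmul p.1 p.2 :=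
  (UniformSpace.Completion.continuous_coe _).comp TensorProduct.continuous_tmul

theorem stronglyMeasurable_hilbertTmul {S : Type*} [MeasurableSpace S] {f : S → A} {g : S → B}
    (hf : StronglyMeasurable f) (hg : StronglyMeasurable g) :
    StronglyMeasurable fun s => hilbertTmul (f s) (g s) :=
  continuous_hilbertTmul.comp_stronglyMeasurable (hf.prodMk hg)

theorem norm_sq_sum_hilbertTmul {ι : Type*} (s : Finset ι) (w : ι → A) (u : ι → B) :
    ‖∑ i ∈ s, hilbertTmul (w i) (u i)‖ ^ 2
      = ∑ i ∈ s, ∑ j ∈ s, inner ℝ (w i) (w j) * inner ℝ (u i) (u j) := by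
  simp only [← real_inner_self_eq_norm_sq, sum_inner, inner_sum, inner_hilbertTmul]
  exact Finset.sum_comm

/-- Parseval in the span of the vectors `u i`: finitely many `e m` suffice, whatever the dimension
of `B`. -/
theorem exists_inner_eq_sum_mul {ι : Type*} (s : Finset ι) (u : ι → B) :
    ∃ (N : ℕ) (e : Fin N → B), ∀ i ∈ s, ∀ j ∈ s,
      inner ℝ (u i) (u j) = ∑ m, inner ℝ (u i) (e m) * inner ℝ (u j) (e m) := by
  set U : Submodule ℝ B := Submodule.span ℝ (u '' s) with hU
  have : FiniteDimensional ℝ U := FiniteDimensional.span_of_finite ℝ (s.finite_toSet.image u)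
  set b := stdOrthonormalBasis ℝ U
  refine ⟨_, fun m => (b m : B), fun i hi j hj => ?_⟩
  have hm : ∀ i ∈ s, u i ∈ U := fun i hi => Submodule.subset_span ⟨i, hi, rfl⟩
  have h := b.sum_inner_mul_inner ⟨u i, hm i hi⟩ ⟨u j, hm j hj⟩
  simp only [Submodule.coe_inner] at h
  rw [← h]
  refine Finset.sum_congr rfl fun m _ => ?_
  rw [real_inner_comm (u j)]

/-- With `T = ∑ ⟪w i, ·⟫ u i`, the summands on the right are `‖T* (e m)‖²`: this computes the
squared Hilbert-Schmidt norm through the adjoint. -/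
theorem norm_sq_sum_smul_eq_sum {ι : Type*} {s : Finset ι} {u : ι → B} {N : ℕ} {e : Fin N → B}
    (he : ∀ i ∈ s, ∀ j ∈ s,
      inner ℝ (u i) (u j) = ∑ m, inner ℝ (u i) (e m) * inner ℝ (u j) (e m)) (w : ι → A) :
    ∑ i ∈ s, ∑ j ∈ s, inner ℝ (w i) (w j) * inner ℝ (u i) (u j)
      = ∑ m, ‖∑ i ∈ s, inner ℝ (u i) (e m) • w i‖ ^ 2 := by
  have h1 : ∀ m, ‖∑ i ∈ s, inner ℝ (u i) (e m) • w i‖ ^ 2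
      = ∑ i ∈ s, ∑ j ∈ s,
        inner ℝ (w i) (w j) * (inner ℝ (u i) (e m) * inner ℝ (u j) (e m)) := fun m => by
    simp only [← real_inner_self_eq_norm_sq, sum_inner, inner_sum, real_inner_smul_left,
      real_inner_smul_right]
    refine Finset.sum_congr rfl fun i _ => Finset.sum_congr rfl fun j _ => ?_
    rw [real_inner_comm (w i) (w j)]
    ring
  simp only [h1]
  symm
  rw [Finset.sum_comm]
  refine Finset.sum_congr rfl fun i hi => ?_
  rw [Finset.sum_comm]
  refine Finset.sum_congr rfl fun j hj => ?_
  rw [← Finset.mul_sum, he i hi j hj]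

/-- For a finite rank operator `T = ∑ᵢ ⟪wᵢ, ·⟫ uᵢ`, the form `‖T a‖²` is the inner product of
`a ⊗ a` with a tensor of norm at most the squared Hilbert-Schmidt norm of `T`. -/
theorem exists_inner_hilbertTmul_self_eq {ι : Type*} (s : Finset ι) (w : ι → A) (u : ι → B) :
    ∃ T : UniformSpace.Completion (A ⊗[ℝ] A),
      ‖T‖ ≤ ‖∑ i ∈ s, hilbertTmul (w i) (u i)‖ ^ 2 ∧
      ∀ a, ‖∑ i ∈ s, inner ℝ (w i) a • u i‖ ^ 2 = inner ℝ T (hilbertTmul a a) := by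
  obtain ⟨N, e, he⟩ := exists_inner_eq_sum_mul s u
  -- The witness represents `T* T = ∑ v_m ⊗ v_m` with `v_m = T* (e m)`. The triangle inequality
  -- bounds its norm by `∑ ‖v_m‖²`, the squared Hilbert-Schmidt norm of `T`.
  refine ⟨∑ m, hilbertTmul (∑ i ∈ s, inner ℝ (u i) (e m) • w i)
    (∑ i ∈ s, inner ℝ (u i) (e m) • w i), ?_, fun a => ?_⟩
  · rw [norm_sq_sum_hilbertTmul, norm_sq_sum_smul_eq_sum he]
    refine norm_sum_le_of_le _ fun m _ => ?_
    rw [norm_hilbertTmul, sq]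
  · have h := norm_sq_sum_smul_eq_sum he fun i => (inner ℝ (w i) a : ℝ)
    have h2 : ‖∑ i ∈ s, inner ℝ (w i) a • u i‖ ^ 2
        = ∑ i ∈ s, ∑ j ∈ s,
          inner ℝ (inner ℝ (w i) a : ℝ) (inner ℝ (w j) a : ℝ) * inner ℝ (u i) (u j) := by
      simp only [← real_inner_self_eq_norm_sq, sum_inner, inner_sum, real_inner_smul_left,
        real_inner_smul_right]
      refine Finset.sum_congr rfl fun i _ => Finset.sum_congr rfl fun j _ => ?_
      rw [real_inner_comm (u i) (u j)]
      simp
      ring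
    rw [h2, h, sum_inner]
    refine Finset.sum_congr rfl fun m _ => ?_
    rw [inner_hilbertTmul, sum_inner, ← sq, Real.norm_eq_abs, sq_abs]
    simp only [real_inner_smul_left, smul_eq_mul]

end HilbertTensor

/-! ### Functions in `G` as tensors. -/

section ScalarTypeKernel

variable {𝒵 V HZ G : Type*} [NormedAddCommGroup V] [InnerProductSpace ℝ V] [CompleteSpace V]
  [NormedAddCommGroup HZ] [InnerProductSpace ℝ HZ] [CompleteSpace HZ] [RKHS ℝ HZ 𝒵 ℝ]
  [NormedAddCommGroup G] [InnerProductSpace ℝ G] [CompleteSpace G] [RKHS ℝ G 𝒵 V]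

theorem norm_pointEmbedding_le {B : ℝ} (hB : 0 ≤ B) (hk : ∀ z, scalarKernel HZ z z ≤ B ^ 2)
    (z : 𝒵) : ‖pointEmbedding HZ z‖ ≤ B := by
  refine le_of_sq_le_sq ?_ hB
  rw [← real_inner_self_eq_norm_sq, ← scalarKernel_eq_inner]
  exact hk z

theorem HasScalarTypeKernel.inner_kerFun_kerFun (hG : HasScalarTypeKernel HZ G) (z z' : 𝒵)
    (u u' : V) : inner ℝ (RKHS.kerFun G z u) (RKHS.kerFun G z' u')
      = inner ℝ (hilbertTmul (pointEmbedding HZ z) u) (hilbertTmul (pointEmbedding HZ z') u') := by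
  rw [RKHS.kerFun_inner, RKHS.kerFun_apply, hG, inner_hilbertTmul, ← scalarKernel_eq_inner,
    smul_apply, ContinuousLinearMap.id_apply, real_inner_smul_right]

/-- The map sending `l(z, ·) u` to `k_z ⊗ u` preserves inner products; concentration for tensors
thus transfers to `G`. -/
theorem HasScalarTypeKernel.norm_sum_kerFun (hG : HasScalarTypeKernel HZ G) {ι : Type*}
    (s : Finset ι) (z : ι → 𝒵) (u : ι → V) :
    ‖∑ i ∈ s, RKHS.kerFun G (z i) (u i)‖
      = ‖∑ i ∈ s, hilbertTmul (pointEmbedding HZ (z i)) (u i)‖ := by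
  refine (sq_eq_sq₀ (norm_nonneg _) (norm_nonneg _)).1 ?_
  simp only [← real_inner_self_eq_norm_sq, sum_inner, inner_sum, hG.inner_kerFun_kerFun]

theorem HasScalarTypeKernel.sum_kerFun_apply (hG : HasScalarTypeKernel HZ G) {ι : Type*}
    (s : Finset ι) (z : ι → 𝒵) (u : ι → V) (z' : 𝒵) :
    (∑ i ∈ s, RKHS.kerFun G (z i) (u i)) z'
      = ∑ i ∈ s, inner ℝ (pointEmbedding HZ (z i)) (pointEmbedding HZ z') • u i := by
  rw [← RKHS.adjoint_kerFun, map_sum]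
  refine Finset.sum_congr rfl fun i _ => ?_
  rw [RKHS.adjoint_kerFun, RKHS.kerFun_apply, hG, real_inner_comm, ← scalarKernel_eq_inner]
  rfl

theorem HasScalarTypeKernel.inner_sum_kerFun_apply (hG : HasScalarTypeKernel HZ G) {ι : Type*}
    (s : Finset ι) (z : ι → 𝒵) (u : ι → V) (z' : 𝒵) (v : V) :
    inner ℝ ((∑ i ∈ s, RKHS.kerFun G (z i) (u i)) z') v
      = inner ℝ (∑ i ∈ s, hilbertTmul (pointEmbedding HZ (z i)) (u i))
          (hilbertTmul (pointEmbedding HZ z') v) := by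
  rw [hG.sum_kerFun_apply]
  simp only [sum_inner, inner_hilbertTmul, real_inner_smul_left]

theorem HasScalarTypeKernel.exists_norm_sq_sum_kerFun_apply (hG : HasScalarTypeKernel HZ G)
    {ι : Type*} (s : Finset ι) (z : ι → 𝒵) (u : ι → V) :
    ∃ T : UniformSpace.Completion (TensorProduct ℝ HZ HZ),
      ‖T‖ ≤ ‖∑ i ∈ s, RKHS.kerFun G (z i) (u i)‖ ^ 2 ∧
      ∀ z', ‖(∑ i ∈ s, RKHS.kerFun G (z i) (u i)) z'‖ ^ 2
        = inner ℝ T (hilbertTmul (pointEmbedding HZ z') (pointEmbedding HZ z')) := by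
  obtain ⟨T, hT, h⟩ := exists_inner_hilbertTmul_self_eq s (fun i => pointEmbedding HZ (z i)) u
  refine ⟨T, by rwa [hG.norm_sum_kerFun], fun z' => ?_⟩
  rw [hG.sum_kerFun_apply, h]

theorem HasScalarTypeKernel.norm_apply_le (hG : HasScalarTypeKernel HZ G) {B : ℝ} (hB : 0 ≤ B)
    (hk : ∀ z, scalarKernel HZ z z ≤ B ^ 2) (F : G) (z : 𝒵) : ‖F z‖ ≤ B * ‖F‖ := by
  refine (RKHS.norm_apply_le F z).trans ?_
  rw [mul_comm]
  gcongr
  refine Real.sqrt_le_iff.2 ⟨hB, ?_⟩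
  rw [hG, norm_smul]
  have h0 : 0 ≤ scalarKernel HZ z z := by
    rw [scalarKernel_eq_inner]
    exact real_inner_self_nonneg
  rw [Real.norm_of_nonneg h0]
  exact (mul_le_of_le_one_right h0 ContinuousLinearMap.norm_id_le).trans (hk z)

theorem exists_sum_kerFun_of_mem_span {F : G}
    (hF : F ∈ Submodule.span ℝ {RKHS.kerFun G z v | (z : 𝒵) (v : V)}) :
    ∃ (s : Finset (𝒵 × V)) (u : 𝒵 × V → V), F = ∑ p ∈ s, RKHS.kerFun G p.1 (u p) := by
  have hset : {RKHS.kerFun G z v | (z : 𝒵) (v : V)}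
      = Set.range fun p : 𝒵 × V => RKHS.kerFun G p.1 p.2 := by
    ext
    simp
  rw [hset, Finsupp.mem_span_range_iff_exists_finsupp] at hF
  obtain ⟨c, rfl⟩ := hF
  exact ⟨c.support, fun p => c p • p.2, by simp [Finsupp.sum]⟩

end ScalarTypeKernel

/-! ### Deviations of empirical means. -/

section MeanDeviation

variable {S E : Type*} [MeasurableSpace S] [NormedAddCommGroup E] [InnerProductSpace ℝ E]

/-- The deviation of the empirical mean of `ξ` over the data `D` from its expectation. -/
noncomputable def meanDeviation (μ : Measure S) (ξ : S → E) {n : ℕ} (D : Fin n → S) : E :=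
  (1 / (n : ℝ)) • ∑ i, ξ (D i) - ∫ s, ξ s ∂μ

theorem inner_meanDeviation [CompleteSpace E] {μ : Measure S} {ξ : S → E} (hξ : Integrable ξ μ)
    {n : ℕ} (D : Fin n → S) (v : E) :
    inner ℝ v (meanDeviation μ ξ D) = meanDeviation μ (fun s => (inner ℝ v (ξ s) : ℝ)) D := by
  rw [meanDeviation, meanDeviation, inner_sub_right, real_inner_smul_right, inner_sum,
    integral_inner hξ, smul_eq_mul]

end MeanDeviation

/-! ### Deterministic bounds on the estimator. -/

section EstimatorBounds

variable {𝒳 𝒵 HX HZ G : Type*}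
  [NormedAddCommGroup HX] [InnerProductSpace ℝ HX] [CompleteSpace HX] [RKHS ℝ HX 𝒳 ℝ]
  [NormedAddCommGroup HZ] [InnerProductSpace ℝ HZ] [CompleteSpace HZ] [RKHS ℝ HZ 𝒵 ℝ]
  [NormedAddCommGroup G] [InnerProductSpace ℝ G] [CompleteSpace G] [RKHS ℝ G 𝒵 HX]
  {BX BZ : ℝ}

theorem norm_pointEmbedding_tmul_le (hBX : 0 ≤ BX) (hBZ : 0 ≤ BZ)
    (hkX : ∀ x : 𝒳, scalarKernel HX x x ≤ BX ^ 2) (hkZ : ∀ z : 𝒵, scalarKernel HZ z z ≤ BZ ^ 2)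
    (s : 𝒳 × 𝒵) : ‖hilbertTmul (pointEmbedding HZ s.2) (pointEmbedding HX s.1)‖ ≤ BX * BZ := by
  rw [norm_hilbertTmul, mul_comm]
  gcongr
  · exact norm_pointEmbedding_le hBX hkX _
  · exact norm_pointEmbedding_le hBZ hkZ _

theorem norm_pointEmbedding_norm_sq_le (hBX : 0 ≤ BX)
    (hkX : ∀ x : 𝒳, scalarKernel HX x x ≤ BX ^ 2) (s : 𝒳 × 𝒵) :
    ‖‖pointEmbedding HX s.1‖ ^ 2‖ ≤ BX ^ 2 := by
  rw [norm_pow, norm_norm]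
  gcongr
  exact norm_pointEmbedding_le hBX hkX _

theorem regularizedEmpiricalRisk_cmeEstimator_le (hG : HasScalarTypeKernel HZ G) {n : ℕ}
    (hn : 1 ≤ n) {lam : ℝ} (hlam : 0 < lam) (D : Fin n → 𝒳 × 𝒵) (F : G) :
    regularizedEmpiricalRisk lam D (cmeEstimator HZ G lam D) ≤ regularizedEmpiricalRisk lam D F := by
  by_cases hF : F = cmeEstimator HZ G lam D
  · rw [hF]
  · exact (regularizedEmpiricalRisk_cmeEstimator_lt HZ G hG hn hlam D F hF).le

/-- Compare with the zero function, whose regularised empirical risk is at most `BX ^ 2`. -/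
theorem norm_cmeEstimator_le (hG : HasScalarTypeKernel HZ G) (hBX : 0 ≤ BX)
    (hkX : ∀ x : 𝒳, scalarKernel HX x x ≤ BX ^ 2) {n : ℕ} (hn : 1 ≤ n) {lam : ℝ}
    (hlam : 0 < lam) (D : Fin n → 𝒳 × 𝒵) : ‖cmeEstimator HZ G lam D‖ ≤ BX / √lam := by
  have hn' : (0 : ℝ) < n := by exact_mod_cast hn
  have h := regularizedEmpiricalRisk_cmeEstimator_le hG hn hlam D 0
  simp only [regularizedEmpiricalRisk, RKHS.coe_zero, Pi.zero_apply, sub_zero, norm_zero] at h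
  have h1 : ∑ i, ‖pointEmbedding HX (D i).1‖ ^ 2 ≤ n * BX ^ 2 := by
    have := Finset.sum_le_card_nsmul Finset.univ (fun i => ‖pointEmbedding HX (D i).1‖ ^ 2)
      (BX ^ 2) fun i _ => by
        gcongr
        exact norm_pointEmbedding_le hBX hkX _
    simpa using this
  have h2 : (1 / (n : ℝ)) * ∑ i, ‖pointEmbedding HX (D i).1‖ ^ 2 ≤ BX ^ 2 := by
    rw [one_div, inv_mul_le_iff₀ hn']
    exact h1
  have h3 : 0 ≤ (1 / (n : ℝ)) * ∑ i, ‖pointEmbedding HX (D i).1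
      - cmeEstimator HZ G lam D (D i).2‖ ^ 2 := by positivity
  refine le_of_sq_le_sq ?_ (by positivity)
  rw [div_pow, Real.sq_sqrt hlam.le, le_div_iff₀ hlam]
  linarith

end EstimatorBounds

/-! ### Uniform control of second moments over `G`. -/

section SecondMoment

variable {𝒳 𝒵 V HZ G : Type*} [NormedAddCommGroup V] [InnerProductSpace ℝ V] [CompleteSpace V]
  [NormedAddCommGroup HZ] [InnerProductSpace ℝ HZ] [CompleteSpace HZ] [RKHS ℝ HZ 𝒵 ℝ]
  [NormedAddCommGroup G] [InnerProductSpace ℝ G] [CompleteSpace G] [RKHS ℝ G 𝒵 V] {BZ : ℝ}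

theorem norm_pointEmbedding_tmul_self_le (hBZ : 0 ≤ BZ)
    (hkZ : ∀ z : 𝒵, scalarKernel HZ z z ≤ BZ ^ 2) (s : 𝒳 × 𝒵) :
    ‖hilbertTmul (pointEmbedding HZ s.2) (pointEmbedding HZ s.2)‖ ≤ BZ ^ 2 := by
  rw [norm_hilbertTmul, ← sq]
  gcongr
  exact norm_pointEmbedding_le hBZ hkZ _

variable [MeasurableSpace 𝒳] [MeasurableSpace 𝒵] {μ : Measure (𝒳 × 𝒵)} [IsProbabilityMeasure μ]

theorem stronglyMeasurable_pointEmbedding_tmul_self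
    (hZmeas : StronglyMeasurable (fun z : 𝒵 => pointEmbedding HZ z)) :
    StronglyMeasurable fun s : 𝒳 × 𝒵 =>
      hilbertTmul (pointEmbedding HZ s.2) (pointEmbedding HZ s.2) :=
  stronglyMeasurable_hilbertTmul (hZmeas.comp_measurable measurable_snd)
    (hZmeas.comp_measurable measurable_snd)

theorem stronglyMeasurable_sum_kerFun (hG : HasScalarTypeKernel HZ G)
    (hZmeas : StronglyMeasurable (fun z : 𝒵 => pointEmbedding HZ z))
    {ι : Type*} (t : Finset ι) (z : ι → 𝒵) (u : ι → V) :
    StronglyMeasurable ⇑(∑ i ∈ t, RKHS.kerFun G (z i) (u i)) := by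
  have : ⇑(∑ i ∈ t, RKHS.kerFun G (z i) (u i))
      = fun z' => ∑ i ∈ t, inner ℝ (pointEmbedding HZ (z i)) (pointEmbedding HZ z') • u i :=
    funext fun z' => hG.sum_kerFun_apply t z u z'
  rw [this]
  exact Finset.stronglyMeasurable_fun_sum _ fun i _ =>
    ((continuous_const.inner continuous_id).comp_stronglyMeasurable hZmeas).smul_const (u i)

/-- Uniform control over `G` of the empirical second moment. -/
theorem abs_meanDeviation_norm_sq_le (hG : HasScalarTypeKernel HZ G)
    (hZmeas : StronglyMeasurable (fun z : 𝒵 => pointEmbedding HZ z)) (hBZ : 0 ≤ BZ)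
    (hkZ : ∀ z : 𝒵, scalarKernel HZ z z ≤ BZ ^ 2) {n : ℕ} (D : Fin n → 𝒳 × 𝒵) (F : G) :
    |meanDeviation μ (fun s => ‖F s.2‖ ^ 2) D|
      ≤ ‖F‖ ^ 2 * ‖meanDeviation μ
          (fun s => hilbertTmul (pointEmbedding HZ s.2) (pointEmbedding HZ s.2)) D‖ := by
  have hi3 : Integrable (fun s : 𝒳 × 𝒵 =>
      hilbertTmul (pointEmbedding HZ s.2) (pointEmbedding HZ s.2)) μ :=
    integrable_of_stronglyMeasurable_of_norm_le
      (stronglyMeasurable_pointEmbedding_tmul_self hZmeas)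
      (norm_pointEmbedding_tmul_self_le hBZ hkZ)
  -- The representing tensor exists for finite combinations only. Both sides pass to norm limits in
  -- `G`: evaluations are continuous and a convergent sequence is uniformly bounded, so dominated
  -- convergence applies. This matters later, when `F` is the estimator minus the true function.
  have hmem : F ∈ closure
      ((Submodule.span ℝ {RKHS.kerFun G z v | (z : 𝒵) (v : V)} : Submodule ℝ G) : Set G) := by
    rw [← Submodule.topologicalClosure_coe, RKHS.kerFun_dense]
    trivial
  obtain ⟨f, hf, hlim⟩ := mem_closure_iff_seq_limit.1 hmem
  choose t u hfu using fun k => exists_sum_kerFun_of_mem_span (hf k)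
  have hspan : ∀ k, |meanDeviation μ (fun s => ‖f k s.2‖ ^ 2) D|
      ≤ ‖f k‖ ^ 2 * ‖meanDeviation μ
          (fun s => hilbertTmul (pointEmbedding HZ s.2) (pointEmbedding HZ s.2)) D‖ := by
    intro k
    obtain ⟨T, hT, hTeq⟩ := hG.exists_norm_sq_sum_kerFun_apply (t k) (fun p => p.1) (u k)
    rw [← hfu] at hT hTeq
    simp only [hTeq]
    rw [← inner_meanDeviation hi3]
    exact (abs_real_inner_le_norm _ _).trans (mul_le_mul_of_nonneg_right hT (norm_nonneg _))
  have hpt : ∀ z : 𝒵, Tendsto (fun k => ‖f k z‖ ^ 2) atTop (𝓝 (‖F z‖ ^ 2)) := fun z =>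
    (((RKHS.continuous_eval z).tendsto F).comp hlim).norm.pow 2
  obtain ⟨C, hC⟩ := hlim.norm.bddAbove_range
  have hint : Tendsto (fun k => ∫ s : 𝒳 × 𝒵, ‖f k s.2‖ ^ 2 ∂μ) atTop
      (𝓝 (∫ s : 𝒳 × 𝒵, ‖F s.2‖ ^ 2 ∂μ)) := by
    refine tendsto_integral_of_dominated_convergence (fun _ => (BZ * C) ^ 2) (fun k => ?_)
      (integrable_const _) (fun k => ae_of_all _ fun s => ?_) (ae_of_all _ fun s => hpt s.2)
    · have h := stronglyMeasurable_sum_kerFun hG hZmeas (t k) (fun p => p.1) (u k)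
      rw [← hfu] at h
      exact ((h.comp_measurable measurable_snd).norm.pow 2).aestronglyMeasurable
    · rw [norm_pow, norm_norm]
      gcongr
      refine (hG.norm_apply_le hBZ hkZ _ _).trans ?_
      gcongr
      exact hC ⟨k, rfl⟩
  have hdev : Tendsto (fun k => meanDeviation μ (fun s => ‖f k s.2‖ ^ 2) D) atTop
      (𝓝 (meanDeviation μ (fun s => ‖F s.2‖ ^ 2) D)) :=
    ((tendsto_finsetSum _ fun i _ => hpt (D i).2).const_smul (1 / (n : ℝ))).sub hint
  exact le_of_tendsto_of_tendsto' hdev.abs ((hlim.norm.pow 2).mul_const _) hspan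

end SecondMoment

/-! ### Deterministic bounds on the excess risk. -/

section ExcessRisk

variable {𝒳 𝒵 HX HZ G : Type*} [MeasurableSpace 𝒳] [MeasurableSpace 𝒵]
  [NormedAddCommGroup HX] [InnerProductSpace ℝ HX] [CompleteSpace HX] [RKHS ℝ HX 𝒳 ℝ]
  [NormedAddCommGroup HZ] [InnerProductSpace ℝ HZ] [CompleteSpace HZ] [RKHS ℝ HZ 𝒵 ℝ]
  [NormedAddCommGroup G] [InnerProductSpace ℝ G] [CompleteSpace G] [RKHS ℝ G 𝒵 HX]
  {μ : Measure (𝒳 × 𝒵)} [IsProbabilityMeasure μ] {BX BZ : ℝ}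

theorem stronglyMeasurable_pointEmbedding_tmul
    (hXmeas : StronglyMeasurable (fun x : 𝒳 => pointEmbedding HX x))
    (hZmeas : StronglyMeasurable (fun z : 𝒵 => pointEmbedding HZ z)) :
    StronglyMeasurable fun s : 𝒳 × 𝒵 =>
      hilbertTmul (pointEmbedding HZ s.2) (pointEmbedding HX s.1) :=
  stronglyMeasurable_hilbertTmul (hZmeas.comp_measurable measurable_snd)
    (hXmeas.comp_measurable measurable_fst)

theorem stronglyMeasurable_pointEmbedding_norm_sq
    (hXmeas : StronglyMeasurable (fun x : 𝒳 => pointEmbedding HX x)) :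
    StronglyMeasurable fun s : 𝒳 × 𝒵 => ‖pointEmbedding HX s.1‖ ^ 2 :=
  (hXmeas.comp_measurable measurable_fst).norm.pow 2

/-- Uniform control of the empirical risk over the finite combinations of kernel functions. -/
theorem abs_meanDeviation_loss_le (hG : HasScalarTypeKernel HZ G)
    (hXmeas : StronglyMeasurable (fun x : 𝒳 => pointEmbedding HX x))
    (hZmeas : StronglyMeasurable (fun z : 𝒵 => pointEmbedding HZ z))
    (hBX : 0 ≤ BX) (hBZ : 0 ≤ BZ)
    (hkX : ∀ x : 𝒳, scalarKernel HX x x ≤ BX ^ 2) (hkZ : ∀ z : 𝒵, scalarKernel HZ z z ≤ BZ ^ 2)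
    {n : ℕ} (D : Fin n → 𝒳 × 𝒵) {ι : Type*} (t : Finset ι) (z : ι → 𝒵) (u : ι → HX) {F : G}
    (hF : F = ∑ i ∈ t, RKHS.kerFun G (z i) (u i)) :
    |meanDeviation μ (fun s => ‖pointEmbedding HX s.1 - F s.2‖ ^ 2) D|
      ≤ ‖meanDeviation μ (fun s => ‖pointEmbedding HX s.1‖ ^ 2) D‖
        + 2 * ‖F‖ * ‖meanDeviation μ
            (fun s => hilbertTmul (pointEmbedding HZ s.2) (pointEmbedding HX s.1)) D‖
        + ‖F‖ ^ 2 * ‖meanDeviation μ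
            (fun s => hilbertTmul (pointEmbedding HZ s.2) (pointEmbedding HZ s.2)) D‖ := by
  obtain ⟨T, hT, hTeq⟩ := hG.exists_norm_sq_sum_kerFun_apply t z u
  have hVeq := hG.inner_sum_kerFun_apply t z u
  have hVn := hG.norm_sum_kerFun t z u
  rw [← hF] at hT hTeq hVeq hVn
  set V := ∑ i ∈ t, hilbertTmul (pointEmbedding HZ (z i)) (u i)
  have hi1 : Integrable (fun s : 𝒳 × 𝒵 => ‖pointEmbedding HX s.1‖ ^ 2) μ :=
    integrable_of_stronglyMeasurable_of_norm_le (stronglyMeasurable_pointEmbedding_norm_sq hXmeas)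
      (norm_pointEmbedding_norm_sq_le hBX hkX)
  have hi2 : Integrable (fun s : 𝒳 × 𝒵 =>
      hilbertTmul (pointEmbedding HZ s.2) (pointEmbedding HX s.1)) μ :=
    integrable_of_stronglyMeasurable_of_norm_le
      (stronglyMeasurable_pointEmbedding_tmul hXmeas hZmeas)
      (norm_pointEmbedding_tmul_le hBX hBZ hkX hkZ)
  have hi3 : Integrable (fun s : 𝒳 × 𝒵 =>
      hilbertTmul (pointEmbedding HZ s.2) (pointEmbedding HZ s.2)) μ :=
    integrable_of_stronglyMeasurable_of_norm_le
      (stronglyMeasurable_pointEmbedding_tmul_self hZmeas)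
      (norm_pointEmbedding_tmul_self_le hBZ hkZ)
  -- `F` enters only through `V` and `T`, which do not depend on the data point.
  have hloss : ∀ s : 𝒳 × 𝒵, ‖pointEmbedding HX s.1 - F s.2‖ ^ 2
      = ‖pointEmbedding HX s.1‖ ^ 2
        - 2 * inner ℝ V (hilbertTmul (pointEmbedding HZ s.2) (pointEmbedding HX s.1))
        + inner ℝ T (hilbertTmul (pointEmbedding HZ s.2) (pointEmbedding HZ s.2)) := fun s => by
    rw [norm_sub_sq_real, hTeq, real_inner_comm, hVeq]
  have hi12 : Integrable (fun s : 𝒳 × 𝒵 => ‖pointEmbedding HX s.1‖ ^ 2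
      - 2 * inner ℝ V (hilbertTmul (pointEmbedding HZ s.2) (pointEmbedding HX s.1))) μ :=
    hi1.sub ((hi2.const_inner V).const_mul 2)
  have hdev : meanDeviation μ (fun s => ‖pointEmbedding HX s.1 - F s.2‖ ^ 2) D
      = meanDeviation μ (fun s => ‖pointEmbedding HX s.1‖ ^ 2) D
        - 2 * inner ℝ V (meanDeviation μ
            (fun s => hilbertTmul (pointEmbedding HZ s.2) (pointEmbedding HX s.1)) D)
        + inner ℝ T (meanDeviation μ
            (fun s => hilbertTmul (pointEmbedding HZ s.2) (pointEmbedding HZ s.2)) D) := by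
    rw [inner_meanDeviation hi2, inner_meanDeviation hi3]
    simp only [meanDeviation, hloss]
    rw [integral_add hi12 (hi3.const_inner T),
      integral_sub hi1 ((hi2.const_inner V).const_mul 2), integral_const_mul,
      Finset.sum_add_distrib, Finset.sum_sub_distrib, ← Finset.mul_sum]
    simp only [smul_eq_mul]
    ring
  rw [hdev]
  have h2 := abs_real_inner_le_norm V (meanDeviation μ
    (fun s => hilbertTmul (pointEmbedding HZ s.2) (pointEmbedding HX s.1)) D)
  have h3 := (abs_real_inner_le_norm T (meanDeviation μ
    (fun s => hilbertTmul (pointEmbedding HZ s.2) (pointEmbedding HZ s.2)) D)).trans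
    (mul_le_mul_of_nonneg_right hT (norm_nonneg _))
  rw [← hVn] at h2
  refine (abs_add_le _ _).trans (add_le_add ((abs_sub _ _).trans ?_) h3)
  rw [abs_mul, abs_two, Real.norm_eq_abs, mul_assoc]
  gcongr

/-- The excess risk bound on the event where the relevant empirical means are accurate. -/
theorem risk_cmeEstimator_sub_le (hG : HasScalarTypeKernel HZ G)
    (hXmeas : StronglyMeasurable (fun x : 𝒳 => pointEmbedding HX x))
    (hZmeas : StronglyMeasurable (fun z : 𝒵 => pointEmbedding HZ z))
    (hBX : 0 ≤ BX) (hBZ : 0 ≤ BZ)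
    (hkX : ∀ x : 𝒳, scalarKernel HX x x ≤ BX ^ 2) (hkZ : ∀ z : 𝒵, scalarKernel HZ z z ≤ BZ ^ 2)
    {n : ℕ} (hn : 1 ≤ n) {lam : ℝ} (hlam : 0 < lam) (D : Fin n → 𝒳 × 𝒵) (F : G) {ε : ℝ}
    (h1 : ‖meanDeviation μ (fun s => ‖pointEmbedding HX s.1‖ ^ 2) D‖ ≤ BX ^ 2 * ε)
    (h2 : ‖meanDeviation μ
      (fun s => hilbertTmul (pointEmbedding HZ s.2) (pointEmbedding HX s.1)) D‖ ≤ BX * BZ * ε)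
    (h3 : ‖meanDeviation μ
      (fun s => hilbertTmul (pointEmbedding HZ s.2) (pointEmbedding HZ s.2)) D‖ ≤ BZ ^ 2 * ε)
    (h4 : ‖meanDeviation μ (fun s => ‖pointEmbedding HX s.1 - F s.2‖ ^ 2) D‖
      ≤ (BZ * ‖F‖ + BX) ^ 2 * ε) :
    ∫ s, ‖pointEmbedding HX s.1 - cmeEstimator HZ G lam D s.2‖ ^ 2 ∂μ
        - ∫ s, ‖pointEmbedding HX s.1 - F s.2‖ ^ 2 ∂μ
      ≤ lam * ‖F‖ ^ 2
        + ε / lam * ((BZ * ‖F‖ + BX) ^ 2 * lam + BX ^ 2 * (BZ + √lam) ^ 2) := by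
  -- The estimator depends on the data, but the bound is uniform in the combination, so it may be
  -- inserted.
  have hbound := abs_meanDeviation_loss_le (μ := μ) hG hXmeas hZmeas hBX hBZ hkX hkZ D
    Finset.univ (fun i => (D i).2) _ (rfl : cmeEstimator HZ G lam D = _)
  have hR := norm_cmeEstimator_le hG hBX hkX hn hlam D
  have hmin := regularizedEmpiricalRisk_cmeEstimator_le hG hn hlam D F
  simp only [regularizedEmpiricalRisk] at hmin
  set Fh := cmeEstimator HZ G lam D with hFh
  have hs := Real.sqrt_pos.2 hlam
  have hlamF : 0 ≤ lam * ‖Fh‖ ^ 2 := by positivity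
  have e1 := neg_abs_le (meanDeviation μ (fun s => ‖pointEmbedding HX s.1 - Fh s.2‖ ^ 2) D)
  have e4 := (le_abs_self _).trans h4
  have hdev : |meanDeviation μ (fun s => ‖pointEmbedding HX s.1 - Fh s.2‖ ^ 2) D|
      ≤ BX ^ 2 * ε + 2 * (BX / √lam) * (BX * BZ * ε) + (BX / √lam) ^ 2 * (BZ ^ 2 * ε) := by
    refine hbound.trans ?_
    gcongr
  -- The three terms form the square `BX ^ 2 * (1 + BZ / √lam) ^ 2`.
  have hval : BX ^ 2 * ε + 2 * (BX / √lam) * (BX * BZ * ε) + (BX / √lam) ^ 2 * (BZ ^ 2 * ε)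
      = ε / lam * (BX ^ 2 * (BZ + √lam) ^ 2) := by
    have hl : lam = √lam ^ 2 := (Real.sq_sqrt hlam.le).symm
    rw [show ε / lam = ε / √lam ^ 2 by rw [← hl]]
    field_simp
    ring
  have hval2 : ε / lam * ((BZ * ‖F‖ + BX) ^ 2 * lam + BX ^ 2 * (BZ + √lam) ^ 2)
      = (BZ * ‖F‖ + BX) ^ 2 * ε + ε / lam * (BX ^ 2 * (BZ + √lam) ^ 2) := by
    field_simp
  rw [hval2]
  rw [hval] at hdev
  simp only [meanDeviation, smul_eq_mul] at e1 e4 hdev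
  linarith

/-- The basic inequality for the estimator. -/
theorem integral_norm_sq_cmeEstimator_sub_le (hG : HasScalarTypeKernel HZ G)
    (hZmeas : StronglyMeasurable (fun z : 𝒵 => pointEmbedding HZ z)) (hBZ : 0 ≤ BZ)
    (hkZ : ∀ z : 𝒵, scalarKernel HZ z z ≤ BZ ^ 2)
    {n : ℕ} (hn : 1 ≤ n) {lam : ℝ} (hlam : 0 < lam) (D : Fin n → 𝒳 × 𝒵) (F : G) {a : ℝ}
    (h3 : ‖meanDeviation μ
      (fun s => hilbertTmul (pointEmbedding HZ s.2) (pointEmbedding HZ s.2)) D‖ ≤ lam)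
    (ha : ‖(1 / (n : ℝ)) • ∑ i, hilbertTmul (pointEmbedding HZ (D i).2)
      (pointEmbedding HX (D i).1 - F (D i).2)‖ ≤ a) :
    ∫ s, ‖(cmeEstimator HZ G lam D - F) s.2‖ ^ 2 ∂μ ≤ 4 * (a + lam * ‖F‖) ^ 2 / lam := by
  have hn' : (0 : ℝ) < n := by exact_mod_cast hn
  have hmin := regularizedEmpiricalRisk_cmeEstimator_le hG hn hlam D F
  obtain ⟨d, hd⟩ : ∃ d, cmeEstimator HZ G lam D = F + d := ⟨cmeEstimator HZ G lam D - F, by abel⟩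
  have hd' : cmeEstimator HZ G lam D - F = d := by rw [hd]; abel
  rw [hd']
  rw [hd] at hmin
  have hterm : ∀ i, ‖pointEmbedding HX (D i).1 - (F + d) (D i).2‖ ^ 2
      = ‖pointEmbedding HX (D i).1 - F (D i).2‖ ^ 2
        - 2 * inner ℝ (pointEmbedding HX (D i).1 - F (D i).2) (d (D i).2) + ‖d (D i).2‖ ^ 2 := by
    intro i
    rw [RKHS.coe_add, Pi.add_apply, ← sub_sub, norm_sub_sq_real]
  -- Up to the factor `-2`, the gradient at `F` of the unregularised empirical risk.
  set η : G := (1 / (n : ℝ)) •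
    ∑ i, RKHS.kerFun G (D i).2 (pointEmbedding HX (D i).1 - F (D i).2) with hη
  have hηn : ‖η‖ ≤ a := by
    rw [hη, norm_smul, hG.norm_sum_kerFun, ← norm_smul]
    exact ha
  have hηd : (1 / (n : ℝ)) * ∑ i, inner ℝ (pointEmbedding HX (D i).1 - F (D i).2) (d (D i).2)
      = inner ℝ η d := by
    rw [hη, real_inner_smul_left, sum_inner]
    simp only [RKHS.kerFun_inner]
  have hbasic : (1 / (n : ℝ)) * ∑ i, ‖d (D i).2‖ ^ 2 + lam * ‖d‖ ^ 2
      ≤ 2 * inner ℝ η d - 2 * lam * inner ℝ F d := by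
    simp only [regularizedEmpiricalRisk, hterm, Finset.sum_add_distrib, Finset.sum_sub_distrib,
      ← Finset.mul_sum, norm_add_sq_real] at hmin
    rw [← hηd]
    linarith
  have c1 : inner ℝ η d ≤ a * ‖d‖ := (real_inner_le_norm _ _).trans (by gcongr)
  have c2 : -inner ℝ F d ≤ ‖F‖ * ‖d‖ := by
    have := neg_le_of_abs_le (abs_real_inner_le_norm F d)
    linarith
  have c2' := mul_le_mul_of_nonneg_left c2 hlam.le
  set b := a + lam * ‖F‖ with hb
  have ha0 : 0 ≤ a := (norm_nonneg _).trans ha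
  have hb0 : 0 ≤ b := by positivity
  have hmain : (1 / (n : ℝ)) * ∑ i, ‖d (D i).2‖ ^ 2 + lam * ‖d‖ ^ 2 ≤ 2 * b * ‖d‖ := by
    rw [hb]
    nlinarith
  have hq0 : 0 ≤ (1 / (n : ℝ)) * ∑ i, ‖d (D i).2‖ ^ 2 := by positivity
  -- Drop the empirical second moment and divide by `‖d‖`.
  have hdn : lam * ‖d‖ ≤ 2 * b := by
    rcases (norm_nonneg d).eq_or_lt with h0 | h0
    · rw [← h0]
      simpa using hb0
    · refine le_of_mul_le_mul_right ?_ h0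
      nlinarith
  have hdev := (neg_le_of_abs_le (abs_meanDeviation_norm_sq_le (μ := μ) hG hZmeas hBZ hkZ D d))
  have hdev2 : ‖d‖ ^ 2 * ‖meanDeviation μ (fun s : 𝒳 × 𝒵 =>
      hilbertTmul (pointEmbedding HZ s.2) (pointEmbedding HZ s.2)) D‖ ≤ ‖d‖ ^ 2 * lam := by
    gcongr
  -- Replacing the empirical by the true second moment costs at most `lam * ‖d‖ ^ 2`, exactly the
  -- regularisation term in `hmain`.
  have hdev3 : ∫ s, ‖d s.2‖ ^ 2 ∂μ ≤ 2 * b * ‖d‖ := by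
    have h := (neg_le_neg hdev2).trans hdev
    rw [meanDeviation, smul_eq_mul] at h
    linarith
  rw [le_div_iff₀ hlam]
  nlinarith

end ExcessRisk

/-! ### Orthogonality of the residual. -/

section Regression

variable {Ω 𝒳 𝒵 HX : Type*} [MeasurableSpace Ω] [MeasurableSpace 𝒳] [MeasurableSpace 𝒵]
  [NormedAddCommGroup HX] [InnerProductSpace ℝ HX] [CompleteSpace HX] [RKHS ℝ HX 𝒳 ℝ]
  {P : Measure Ω} {X : Ω → 𝒳} {Z : Ω → 𝒵} {F : 𝒵 → HX} {BX C : ℝ}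

theorem surrogateRisk_eq_integral_map
    (hXmeas : StronglyMeasurable (fun x : 𝒳 => pointEmbedding HX x))
    (hX : Measurable X) (hZ : Measurable Z) (hF : StronglyMeasurable F) :
    surrogateRisk P X Z F
      = ∫ s, ‖pointEmbedding HX s.1 - F s.2‖ ^ 2 ∂P.map (fun ω => (X ω, Z ω)) := by
  rw [integral_map (hX.prodMk hZ).aemeasurable]
  · rfl
  · exact (((hXmeas.comp_measurable measurable_fst).sub
      (hF.comp_measurable measurable_snd)).norm.pow 2).aestronglyMeasurable

/-- The residual of the conditional mean is orthogonal to the bounded functions of `Z`. -/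
theorem IsConditionalMeanFunction.integral_inner_residual_eq_zero [IsProbabilityMeasure P]
    (hF : IsConditionalMeanFunction P X Z F)
    (hXmeas : StronglyMeasurable (fun x : 𝒳 => pointEmbedding HX x)) (hBX : 0 ≤ BX)
    (hkX : ∀ x : 𝒳, scalarKernel HX x x ≤ BX ^ 2) (hX : Measurable X) (hZ : Measurable Z)
    (hFC : ∀ z, ‖F z‖ ≤ C) {h : 𝒵 → HX} (hh : StronglyMeasurable h) {C' : ℝ}
    (hhC : ∀ z, ‖h z‖ ≤ C') :
    ∫ s, inner ℝ (h s.2) (pointEmbedding HX s.1 - F s.2) ∂P.map (fun ω => (X ω, Z ω)) = 0 := by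
  have hFm := hF.1
  have hres : StronglyMeasurable fun s : 𝒳 × 𝒵 => pointEmbedding HX s.1 - F s.2 :=
    (hXmeas.comp_measurable measurable_fst).sub (hFm.comp_measurable measurable_snd)
  rw [integral_map (hX.prodMk hZ).aemeasurable
    ((hh.comp_measurable measurable_snd).inner hres).aestronglyMeasurable]
  have hφ : StronglyMeasurable fun ω => pointEmbedding HX (X ω) := hXmeas.comp_measurable hX
  have hφi : Integrable (fun ω => pointEmbedding HX (X ω)) P :=
    integrable_of_stronglyMeasurable_of_norm_le hφ fun ω => norm_pointEmbedding_le hBX hkX _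
  have hhZ : StronglyMeasurable fun ω => h (Z ω) := hh.comp_measurable hZ
  have hbound : ∀ (f : Ω → HX) (K : ℝ), StronglyMeasurable f → (∀ ω, ‖f ω‖ ≤ K) →
      Integrable (fun ω => (inner ℝ (h (Z ω)) (f ω) : ℝ)) P := fun f K hf hK =>
    integrable_of_stronglyMeasurable_of_norm_le (hhZ.inner hf) (C := C' * K) fun ω =>
      (norm_inner_le_norm _ _).trans
        (mul_le_mul (hhC _) (hK ω) (norm_nonneg _) ((norm_nonneg _).trans (hhC (Z ω))))
  have hi1 := hbound _ _ hφ fun ω => norm_pointEmbedding_le hBX hkX _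
  have hi2 := hbound (fun ω => F (Z ω)) _ (hFm.comp_measurable hZ) fun ω => hFC (Z ω)
  -- `h ∘ Z` is measurable for the σ-algebra of `Z`, so it comes out of the conditional expectation.
  have hpull := condExp_bilin_of_stronglyMeasurable_left (μ := P)
    (m := MeasurableSpace.comap Z inferInstance) (innerSL ℝ : HX →L[ℝ] HX →L[ℝ] ℝ)
    (f := fun ω => h (Z ω)) (g := fun ω => pointEmbedding HX (X ω))
    (hh.comp_measurable (comap_measurable Z)) hi1 hφi
  have hint := integral_condExp (μ := P) (m := MeasurableSpace.comap Z inferInstance)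
    hZ.comap_le (f := fun ω => innerSL ℝ (h (Z ω)) (pointEmbedding HX (X ω)))
  have heq : ∫ ω, inner ℝ (h (Z ω)) (pointEmbedding HX (X ω)) ∂P
      = ∫ ω, inner ℝ (h (Z ω)) (F (Z ω)) ∂P := by
    refine hint.symm.trans (integral_congr_ae ?_)
    filter_upwards [hpull, hF.2] with ω h1 h2
    rw [h1, ← h2]
    rfl
  simp only [inner_sub_right]
  rw [integral_sub hi1 hi2, heq, sub_self]

end Regression

/-! ### Consequences of orthogonality. -/

section ExcessRiskIdentity

variable {𝒳 𝒵 HX HZ : Type*}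
  [NormedAddCommGroup HX] [InnerProductSpace ℝ HX] [CompleteSpace HX] [RKHS ℝ HX 𝒳 ℝ]
  [NormedAddCommGroup HZ] [InnerProductSpace ℝ HZ] [CompleteSpace HZ] [RKHS ℝ HZ 𝒵 ℝ]
  {F : 𝒵 → HX} {BX BZ C : ℝ}

theorem norm_residual_le (hBX : 0 ≤ BX) (hkX : ∀ x : 𝒳, scalarKernel HX x x ≤ BX ^ 2)
    {V : 𝒵 → HX} (hV : ∀ z, ‖V z‖ ≤ C) (s : 𝒳 × 𝒵) :
    ‖pointEmbedding HX s.1 - V s.2‖ ≤ BX + C :=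
  (norm_sub_le _ _).trans (add_le_add (norm_pointEmbedding_le hBX hkX _) (hV _))

variable [MeasurableSpace 𝒳] [MeasurableSpace 𝒵] {μ : Measure (𝒳 × 𝒵)} [IsProbabilityMeasure μ]

/-- Pythagoras: `F' - F` is a bounded function of `z`, hence orthogonal to the residual. -/
theorem integral_norm_sq_residual_sub_eq
    (hXmeas : StronglyMeasurable (fun x : 𝒳 => pointEmbedding HX x)) (hBX : 0 ≤ BX)
    (hkX : ∀ x : 𝒳, scalarKernel HX x x ≤ BX ^ 2) (hF : StronglyMeasurable F)
    (hFC : ∀ z, ‖F z‖ ≤ C) {F' : 𝒵 → HX} (hF' : StronglyMeasurable F') {C' : ℝ}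
    (hFC' : ∀ z, ‖F' z‖ ≤ C')
    (horth : ∀ h : 𝒵 → HX, StronglyMeasurable h → ∀ K : ℝ, (∀ z, ‖h z‖ ≤ K) →
      ∫ s, inner ℝ (h s.2) (pointEmbedding HX s.1 - F s.2) ∂μ = 0) :
    ∫ s, ‖pointEmbedding HX s.1 - F' s.2‖ ^ 2 ∂μ - ∫ s, ‖pointEmbedding HX s.1 - F s.2‖ ^ 2 ∂μ
      = ∫ s, ‖F' s.2 - F s.2‖ ^ 2 ∂μ := by
  have hd : StronglyMeasurable fun z => F' z - F z := hF'.sub hF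
  have hdC : ∀ z, ‖F' z - F z‖ ≤ C' + C := fun z =>
    (norm_sub_le _ _).trans (add_le_add (hFC' z) (hFC z))
  have hres : StronglyMeasurable fun s : 𝒳 × 𝒵 => pointEmbedding HX s.1 - F s.2 :=
    (hXmeas.comp_measurable measurable_fst).sub (hF.comp_measurable measurable_snd)
  have hd2 : StronglyMeasurable fun s : 𝒳 × 𝒵 => F' s.2 - F s.2 :=
    hd.comp_measurable measurable_snd
  have hi1 : Integrable (fun s : 𝒳 × 𝒵 => ‖pointEmbedding HX s.1 - F s.2‖ ^ 2) μ :=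
    integrable_of_stronglyMeasurable_of_norm_le (C := (BX + C) ^ 2) (hres.norm.pow 2) fun s => by
      rw [norm_pow, norm_norm]
      gcongr
      exact norm_residual_le hBX hkX hFC s
  have hi2 : Integrable (fun s : 𝒳 × 𝒵 => ‖F' s.2 - F s.2‖ ^ 2) μ :=
    integrable_of_stronglyMeasurable_of_norm_le (C := (C' + C) ^ 2) (hd2.norm.pow 2) fun s => by
      rw [norm_pow, norm_norm]
      gcongr
      exact hdC _
  have hi3 : Integrable (fun s : 𝒳 × 𝒵 =>
      (inner ℝ (F' s.2 - F s.2) (pointEmbedding HX s.1 - F s.2) : ℝ)) μ :=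
    integrable_of_stronglyMeasurable_of_norm_le (C := (C' + C) * (BX + C)) (hd2.inner hres)
      fun s => (norm_inner_le_norm _ _).trans (mul_le_mul (hdC _) (norm_residual_le hBX hkX hFC s)
        (norm_nonneg _) ((norm_nonneg _).trans (hdC s.2)))
  have hexp : ∀ s : 𝒳 × 𝒵, ‖pointEmbedding HX s.1 - F' s.2‖ ^ 2
      = ‖pointEmbedding HX s.1 - F s.2‖ ^ 2 + ‖F' s.2 - F s.2‖ ^ 2
        - 2 * inner ℝ (F' s.2 - F s.2) (pointEmbedding HX s.1 - F s.2) := fun s => by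
    have : pointEmbedding HX s.1 - F' s.2
        = (pointEmbedding HX s.1 - F s.2) - (F' s.2 - F s.2) := by abel
    rw [this, norm_sub_sq_real, real_inner_comm]
    ring
  have h12 : Integrable (fun s : 𝒳 × 𝒵 =>
      ‖pointEmbedding HX s.1 - F s.2‖ ^ 2 + ‖F' s.2 - F s.2‖ ^ 2) μ := hi1.add hi2
  simp only [hexp]
  rw [integral_sub h12 (hi3.const_mul 2), integral_add hi1 hi2, integral_const_mul,
    horth _ hd _ hdC]
  ring

theorem integral_hilbertTmul_residual_eq_zero
    (hXmeas : StronglyMeasurable (fun x : 𝒳 => pointEmbedding HX x))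
    (hZmeas : StronglyMeasurable (fun z : 𝒵 => pointEmbedding HZ z)) (hBX : 0 ≤ BX)
    (hBZ : 0 ≤ BZ) (hkX : ∀ x : 𝒳, scalarKernel HX x x ≤ BX ^ 2)
    (hkZ : ∀ z : 𝒵, scalarKernel HZ z z ≤ BZ ^ 2) (hF : StronglyMeasurable F)
    (hFC : ∀ z, ‖F z‖ ≤ C)
    (horth : ∀ h : 𝒵 → HX, StronglyMeasurable h → ∀ K : ℝ, (∀ z, ‖h z‖ ≤ K) →
      ∫ s, inner ℝ (h s.2) (pointEmbedding HX s.1 - F s.2) ∂μ = 0) :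
    ∫ s, hilbertTmul (pointEmbedding HZ s.2) (pointEmbedding HX s.1 - F s.2) ∂μ = 0 := by
  set ξ := fun s : 𝒳 × 𝒵 =>
    hilbertTmul (pointEmbedding HZ s.2) (pointEmbedding HX s.1 - F s.2) with hξ
  have hξi : Integrable ξ μ := by
    refine integrable_of_stronglyMeasurable_of_norm_le (C := BZ * (BX + C))
      (stronglyMeasurable_hilbertTmul (hZmeas.comp_measurable measurable_snd)
        ((hXmeas.comp_measurable measurable_fst).sub (hF.comp_measurable measurable_snd)))
      fun s => ?_
    rw [norm_hilbertTmul]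
    gcongr
    · exact norm_pointEmbedding_le hBZ hkZ _
    · exact norm_residual_le hBX hkX hFC s
  -- With `s` fixed, `⟪ξ s, ξ s'⟫` pairs the residual at `s'` with a bounded function of `s'.2`. The
  -- mean is thus orthogonal to every `ξ s`, hence to itself.
  have hzero : ∀ s, inner ℝ (ξ s) (∫ s', ξ s' ∂μ) = 0 := by
    intro s
    rw [← integral_inner hξi]
    have hsm : StronglyMeasurable fun z : 𝒵 =>
        (inner ℝ (pointEmbedding HZ s.2) (pointEmbedding HZ z) : ℝ)
          • (pointEmbedding HX s.1 - F s.2) :=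
      ((continuous_const.inner continuous_id).comp_stronglyMeasurable hZmeas).smul_const _
    rw [← horth _ hsm (BZ * BZ * (BX + C)) fun z => ?_]
    · refine integral_congr_ae (ae_of_all _ fun s' => ?_)
      simp only [hξ, inner_hilbertTmul, real_inner_smul_left]
    · rw [norm_smul]
      gcongr
      · refine (norm_inner_le_norm _ _).trans ?_
        gcongr
        · exact norm_pointEmbedding_le hBZ hkZ _
        · exact norm_pointEmbedding_le hBZ hkZ _
      · exact norm_residual_le hBX hkX hFC s
  rw [← norm_eq_zero, ← sq_eq_zero_iff, ← real_inner_self_eq_norm_sq, ← integral_inner hξi]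
  refine (integral_congr_ae (ae_of_all _ fun s => ?_)).trans (integral_zero _ _)
  exact (real_inner_comm _ _).trans (hzero s)

end ExcessRiskIdentity

/-! ### Transfer to an i.i.d. sample. -/

section IndependentSample

/-- Concentration of the empirical mean over an i.i.d. sample. -/
theorem measure_norm_meanDeviation_gt_le {Ω' T E : Type*} [MeasurableSpace Ω'] [MeasurableSpace T]
    [NormedAddCommGroup E] [InnerProductSpace ℝ E] [CompleteSpace E]
    {Q : Measure Ω'} [IsProbabilityMeasure Q] {μ : Measure T} [IsProbabilityMeasure μ]
    {S : ℕ → Ω' → T} (hS : ∀ i, Measurable (S i)) (hindep : iIndepFun S Q)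
    (hlaw : ∀ i, Q.map (S i) = μ) {ξ : T → E} (hξ : StronglyMeasurable ξ) {M : ℝ} (hM0 : 0 < M)
    (hM : ∀ s, ‖ξ s‖ ≤ M) {n : ℕ} (hn : 1 ≤ n) {τ : ℝ} (hτ : 0 ≤ τ) {p : ℝ}
    (hp : Real.exp (-τ) = p) :
    Q {ω | M * ((1 + √(2 * τ)) / √n) < ‖meanDeviation μ ξ fun i : Fin n => S i ω‖}
      ≤ ENNReal.ofReal p := by
  have hmap : Q.map (fun ω (i : Fin n) => S i ω) = Measure.pi fun _ : Fin n => μ := by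
    have h := (iIndepFun_iff_map_fun_eq_pi_map
      (fun i : Fin n => (hS i).aemeasurable)).1 (hindep.precomp Fin.val_injective)
    rw [h]
    simp only [hlaw]
  have hmeas : Measurable fun ω (i : Fin n) => S i ω := measurable_pi_iff.2 fun i => hS i
  rw [← hp]
  refine le_trans ?_ (measure_pi_norm_mean_sub_integral_gt_le (μ := μ) hξ hM0 hM hn hτ)
  rw [← hmap]
  -- This inequality holds for every set, so measurability of the event is not needed.
  exact Measure.le_map_apply hmeas.aemeasurable _

end IndependentSample

/-- For `τ ≥ 1 / 2` the left side is at most `2 * √(2 * τ) / √n`, which equals `2 * τ / (3 * n) *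
√(18 * n / τ)`. -/
theorem one_add_sqrt_div_sqrt_le {τ : ℝ} (hτ : 1 / 2 ≤ τ) {n : ℕ} (hn : 1 ≤ n) :
    (1 + √(2 * τ)) / √n ≤ 2 * τ / (3 * n) * (1 + √(1 + 18 * n / τ)) := by
  have hn' : (0 : ℝ) < n := by exact_mod_cast hn
  have hτ' : 0 < τ := by linarith
  have h1 : 1 ≤ √(2 * τ) := Real.one_le_sqrt.2 (by linarith)
  have h2 : √(18 * n / τ) ≤ 1 + √(1 + 18 * n / τ) := by
    have := Real.sqrt_le_sqrt (show 18 * n / τ ≤ 1 + 18 * n / τ by linarith)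
    linarith
  have h3 : 2 * τ / (3 * n) * √(18 * n / τ) = 2 * √(2 * τ) / √n := by
    have e : 18 * n / τ = (6 * n / √(2 * τ) / √n) ^ 2 := by
      rw [div_pow, div_pow, Real.sq_sqrt (by positivity), Real.sq_sqrt hn'.le]
      field_simp
      norm_num
    rw [e, Real.sqrt_sq (by positivity)]
    have hs : √(2 * τ) ≠ 0 := by positivity
    field_simp
    rw [Real.sq_sqrt (by positivity)]
    ring
  calc (1 + √(2 * τ)) / √n ≤ 2 * √(2 * τ) / √n := by gcongr; linarith
    _ = 2 * τ / (3 * n) * √(18 * n / τ) := h3.symm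
    _ ≤ _ := by gcongr

/-! ### Probabilistic bounds. -/

section Rates

variable {𝒳 𝒵 HX HZ G Ω' : Type*} [MeasurableSpace 𝒳] [MeasurableSpace 𝒵] [MeasurableSpace Ω']
  [NormedAddCommGroup HX] [InnerProductSpace ℝ HX] [CompleteSpace HX] [RKHS ℝ HX 𝒳 ℝ]
  [NormedAddCommGroup HZ] [InnerProductSpace ℝ HZ] [CompleteSpace HZ] [RKHS ℝ HZ 𝒵 ℝ]
  [NormedAddCommGroup G] [InnerProductSpace ℝ G] [CompleteSpace G] [RKHS ℝ G 𝒵 HX]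
  {μ : Measure (𝒳 × 𝒵)} [IsProbabilityMeasure μ] {BX BZ : ℝ}
  {Q : Measure Ω'} [IsProbabilityMeasure Q] {S : ℕ → Ω' → 𝒳 × 𝒵}

/-- The finite sample bound for the excess risk of the estimator. -/
theorem measure_risk_cmeEstimator_sub_gt_le
    (hG : HasScalarTypeKernel HZ G)
    (hXmeas : StronglyMeasurable (fun x : 𝒳 => pointEmbedding HX x))
    (hZmeas : StronglyMeasurable (fun z : 𝒵 => pointEmbedding HZ z))
    (hBX : 0 < BX) (hBZ : 0 < BZ)
    (hkX : ∀ x : 𝒳, scalarKernel HX x x ≤ BX ^ 2) (hkZ : ∀ z : 𝒵, scalarKernel HZ z z ≤ BZ ^ 2)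
    (FG : G) (hFm : StronglyMeasurable FG)
    (hS : ∀ i, Measurable (S i)) (hindep : iIndepFun S Q) (hlaw : ∀ i, Q.map (S i) = μ)
    {n : ℕ} (hn : 1 ≤ n) {lam : ℝ} (hlam : 0 < lam) {δ : ℝ} (hδ0 : 0 < δ) (hδ1 : δ < 1) :
    Q {ω | ¬ (∫ s, ‖pointEmbedding HX s.1
            - cmeEstimator HZ G lam (fun i : Fin n => S i ω) s.2‖ ^ 2 ∂μ
          - ∫ s, ‖pointEmbedding HX s.1 - FG s.2‖ ^ 2 ∂μ
        ≤ lam * ‖FG‖ ^ 2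
          + 2 * Real.log (4 / δ) / (3 * n * lam)
            * (1 + √(1 + 18 * n / Real.log (4 / δ)))
            * ((BZ * ‖FG‖ + BX) ^ 2 * lam + BX ^ 2 * (BZ + √lam) ^ 2))}
      ≤ ENNReal.ofReal δ := by
  have hres (s : 𝒳 × 𝒵) : ‖pointEmbedding HX s.1 - FG s.2‖ ≤ BZ * ‖FG‖ + BX :=
    (norm_residual_le hBX.le hkX (hG.norm_apply_le hBZ.le hkZ FG) s).trans_eq (add_comm _ _)
  have hresC : ∀ s : 𝒳 × 𝒵, ‖‖pointEmbedding HX s.1 - FG s.2‖ ^ 2‖ ≤ (BZ * ‖FG‖ + BX) ^ 2 := by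
    intro s
    rw [norm_pow, norm_norm]
    gcongr
    exact hres s
  have hresm : StronglyMeasurable fun s : 𝒳 × 𝒵 => pointEmbedding HX s.1 - FG s.2 :=
    (hXmeas.comp_measurable measurable_fst).sub (hFm.comp_measurable measurable_snd)
  have hK : 0 < BZ * ‖FG‖ + BX := by positivity
  set τ := Real.log (4 / δ) with hτ
  have hτ1 : 1 / 2 ≤ τ := by
    have h := Real.one_sub_inv_le_log_of_pos (show 0 < 4 / δ by positivity)
    rw [inv_div] at h
    linarith
  have hτ0 : 0 ≤ τ := by linarith
  -- Four deviation events share `δ` equally.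
  have hexp : Real.exp (-τ) = δ / 4 := by
    rw [Real.exp_neg, hτ, Real.exp_log (by positivity), inv_div]
  set ε := (1 + √(2 * τ)) / √n with hε
  have c1 := measure_norm_meanDeviation_gt_le hS hindep hlaw
    (stronglyMeasurable_pointEmbedding_norm_sq hXmeas) (pow_pos hBX 2)
    (norm_pointEmbedding_norm_sq_le hBX.le hkX) hn hτ0 hexp
  have c2 := measure_norm_meanDeviation_gt_le hS hindep hlaw
    (stronglyMeasurable_pointEmbedding_tmul hXmeas hZmeas) (mul_pos hBX hBZ)
    (norm_pointEmbedding_tmul_le hBX.le hBZ.le hkX hkZ) hn hτ0 hexp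
  have c3 := measure_norm_meanDeviation_gt_le hS hindep hlaw
    (stronglyMeasurable_pointEmbedding_tmul_self hZmeas) (pow_pos hBZ 2)
    (norm_pointEmbedding_tmul_self_le hBZ.le hkZ) hn hτ0 hexp
  have c4 := measure_norm_meanDeviation_gt_le hS hindep hlaw
    (ξ := fun s => ‖pointEmbedding HX s.1 - FG s.2‖ ^ 2) (hresm.norm.pow 2) (pow_pos hK 2) hresC
    hn hτ0 hexp
  refine (measure_mono (t := (_ ∪ _) ∪ (_ ∪ _)) fun ω hω => ?_).trans
    ((measure_union_le _ _).trans (add_le_add ((measure_union_le _ _).trans (add_le_add c1 c2))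
      ((measure_union_le _ _).trans (add_le_add c3 c4)))) |>.trans ?_
  · by_contra hnot
    simp only [Set.mem_union, Set.mem_ofPred_eq, not_or, not_lt] at hnot
    obtain ⟨⟨h1, h2⟩, h3, h4⟩ := hnot
    refine hω ?_
    refine (risk_cmeEstimator_sub_le hG hXmeas hZmeas hBX.le hBZ.le hkX hkZ hn hlam _ FG
      h1 h2 h3 h4).trans ?_
    have hε' := one_add_sqrt_div_sqrt_le hτ1 hn
    have hdiv : ε / lam ≤ 2 * τ / (3 * n * lam) * (1 + √(1 + 18 * n / τ)) := by
      rw [div_le_iff₀ hlam]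
      refine hε'.trans_eq ?_
      field_simp
    gcongr
  · rw [← ENNReal.ofReal_add (by positivity) (by positivity),
      ← ENNReal.ofReal_add (by positivity) (by positivity)]
    refine ENNReal.ofReal_le_ofReal (le_of_eq ?_)
    ring

/-- The excess risk of the estimator is `O_p(n ^ (-1/4))`. -/
theorem isBigOInProbability_integral_norm_sq_cmeEstimator_sub
    (hG : HasScalarTypeKernel HZ G)
    (hXmeas : StronglyMeasurable (fun x : 𝒳 => pointEmbedding HX x))
    (hZmeas : StronglyMeasurable (fun z : 𝒵 => pointEmbedding HZ z))
    (hBX : 0 < BX) (hBZ : 0 < BZ)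
    (hkX : ∀ x : 𝒳, scalarKernel HX x x ≤ BX ^ 2) (hkZ : ∀ z : 𝒵, scalarKernel HZ z z ≤ BZ ^ 2)
    (FG : G) (hFm : StronglyMeasurable FG)
    (hS : ∀ i, Measurable (S i)) (hindep : iIndepFun S Q) (hlaw : ∀ i, Q.map (S i) = μ)
    (horth : ∀ h : 𝒵 → HX, StronglyMeasurable h → ∀ K : ℝ, (∀ z, ‖h z‖ ≤ K) →
      ∫ s, inner ℝ (h s.2) (pointEmbedding HX s.1 - FG s.2) ∂μ = 0)
    {lam : ℕ → ℝ} (hlam : ∀ n, 1 ≤ n → 0 < lam n)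
    (hlo : (fun n : ℕ => (n : ℝ) ^ (-(1 / 2) : ℝ)) =o[atTop] lam)
    (hO : lam =O[atTop] (fun n : ℕ => (n : ℝ) ^ (-(1 / 4) : ℝ))) :
    IsBigOInProbability Q
      (fun n ω => ∫ s, ‖(cmeEstimator HZ G (lam n) (fun i : Fin n => S i ω) - FG) s.2‖ ^ 2 ∂μ)
      (fun n : ℕ => (n : ℝ) ^ (-(1 / 4) : ℝ)) := by
  intro ε hε
  have hres (s : 𝒳 × 𝒵) : ‖pointEmbedding HX s.1 - FG s.2‖ ≤ BZ * ‖FG‖ + BX :=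
    (norm_residual_le hBX.le hkX (hG.norm_apply_le hBZ.le hkZ FG) s).trans_eq (add_comm _ _)
  have hresm : StronglyMeasurable fun s : 𝒳 × 𝒵 => pointEmbedding HX s.1 - FG s.2 :=
    (hXmeas.comp_measurable measurable_fst).sub (hFm.comp_measurable measurable_snd)
  have hK : 0 < BZ * ‖FG‖ + BX := by positivity
  have hmean := integral_hilbertTmul_residual_eq_zero hXmeas hZmeas hBX.le hBZ.le hkX hkZ hFm
    (hG.norm_apply_le hBZ.le hkZ FG) horth
  -- Truncation at `1` makes `τ` nonnegative; two events get `ε₀ / 2` each.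
  set ε₀ := min ε 1 with hε₀
  have hε₀0 : 0 < ε₀ := lt_min hε one_pos
  set τ := Real.log (2 / ε₀) with hτ
  have hτ0 : 0 ≤ τ := Real.log_nonneg (by
    rw [le_div_iff₀ hε₀0]
    linarith [min_le_right ε 1])
  have hexp : Real.exp (-τ) = ε₀ / 2 := by
    rw [Real.exp_neg, hτ, Real.exp_log (by positivity), inv_div]
  set κ := 1 + √(2 * τ) with hκ
  have hκ0 : 0 < κ := by positivity
  set B := BZ * (BZ * ‖FG‖ + BX) with hB
  have hB0 : 0 < B := by positivity
  obtain ⟨C, hC⟩ := hO.bound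
  refine ⟨8 * (B ^ 2 * κ / BZ ^ 2 + C * ‖FG‖ ^ 2), ?_⟩
  -- This constant in `n^(-1/2) = o(lam)` yields `BZ ^ 2 * κ / √n ≤ lam n`, the accuracy of the
  -- second moment required by the basic inequality.
  filter_upwards [hC, hlo.def (show 0 < (BZ ^ 2 * κ)⁻¹ by positivity), eventually_ge_atTop 1]
    with n hCn hlon hn
  have hn' : (0 : ℝ) < n := by exact_mod_cast hn
  have hl := hlam n hn
  rw [Real.norm_of_nonneg hl.le, Real.norm_of_nonneg (by positivity)] at hCn hlon
  have hsqrt : (n : ℝ) ^ (-(1 / 2) : ℝ) = 1 / √n := by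
    rw [Real.rpow_neg hn'.le, ← Real.sqrt_eq_rpow, one_div]
  rw [hsqrt, inv_mul_eq_div, le_div_iff₀ (by positivity)] at hlon
  have hpow : 1 / √n ≤ (n : ℝ) ^ (-(1 / 4) : ℝ) := by
    rw [← hsqrt]
    exact Real.rpow_le_rpow_of_exponent_le (by exact_mod_cast hn) (by norm_num)
  have c1 := measure_norm_meanDeviation_gt_le hS hindep hlaw
    (stronglyMeasurable_pointEmbedding_tmul_self hZmeas) (pow_pos hBZ 2)
    (norm_pointEmbedding_tmul_self_le hBZ.le hkZ) hn hτ0 hexp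
  have hξB : ∀ s : 𝒳 × 𝒵,
      ‖hilbertTmul (pointEmbedding HZ s.2) (pointEmbedding HX s.1 - FG s.2)‖ ≤ B := fun s => by
    rw [norm_hilbertTmul]
    exact mul_le_mul (norm_pointEmbedding_le hBZ.le hkZ _) (hres s) (norm_nonneg _) hBZ.le
  have c2 := measure_norm_meanDeviation_gt_le hS hindep hlaw
    (ξ := fun s => hilbertTmul (pointEmbedding HZ s.2) (pointEmbedding HX s.1 - FG s.2))
    (stronglyMeasurable_hilbertTmul (hZmeas.comp_measurable measurable_snd) hresm)
    hB0 hξB hn hτ0 hexp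
  refine (measure_mono (t := _ ∪ _) fun ω hω => ?_).trans
    ((measure_union_le _ _).trans (add_le_add c1 c2)) |>.trans ?_
  · by_contra hnot
    simp only [Set.mem_union, Set.mem_ofPred_eq, not_or, not_lt] at hnot
    obtain ⟨h1, h2⟩ := hnot
    refine (not_le.2 (Set.mem_ofPred_eq ▸ hω)) ?_
    rw [abs_of_nonneg (integral_nonneg fun s => sq_nonneg _)]
    have h2' : ‖(1 / (n : ℝ)) • ∑ i : Fin n, hilbertTmul (pointEmbedding HZ (S i ω).2)
        (pointEmbedding HX (S i ω).1 - FG (S i ω).2)‖ ≤ B * (κ / √n) := by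
      rw [meanDeviation, hmean, sub_zero] at h2
      exact h2
    have h1' : BZ ^ 2 * (κ / √n) ≤ lam n := by
      refine le_trans (le_of_eq ?_) hlon
      ring
    refine (integral_norm_sq_cmeEstimator_sub_le hG hZmeas hBZ.le hkZ hn hl _ FG
      (h1.trans h1') h2').trans ?_
    set r := 1 / √(n : ℝ) with hr
    have hr0 : 0 < r := by positivity
    have ha : B * (κ / √n) = B * κ * r := by rw [hr]; ring
    rw [ha]
    have hsq : (B * κ * r + lam n * ‖FG‖) ^ 2
        ≤ 2 * ((B * κ * r) ^ 2 + (lam n * ‖FG‖) ^ 2) := add_sq_le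
    -- One factor `r` is traded for `lam n`, so the noise term is of order `n^(-1/2)`.
    have e1 : (B * κ * r) ^ 2 / lam n ≤ B ^ 2 * κ / BZ ^ 2 * r := by
      rw [div_le_iff₀ hl]
      calc (B * κ * r) ^ 2 = B ^ 2 * κ / BZ ^ 2 * r * (r * (BZ ^ 2 * κ)) := by
            field_simp
        _ ≤ _ := by gcongr
    calc 4 * (B * κ * r + lam n * ‖FG‖) ^ 2 / lam n
        ≤ 4 * (2 * ((B * κ * r) ^ 2 + (lam n * ‖FG‖) ^ 2)) / lam n := by gcongr
      _ = 8 * ((B * κ * r) ^ 2 / lam n + lam n * ‖FG‖ ^ 2) := by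
          field_simp
          ring
      _ ≤ 8 * (B ^ 2 * κ / BZ ^ 2 * (n : ℝ) ^ (-(1 / 4) : ℝ)
            + C * (n : ℝ) ^ (-(1 / 4) : ℝ) * ‖FG‖ ^ 2) := by
          gcongr
          exact e1.trans (by gcongr)
      _ = _ := by ring
  · rw [← ENNReal.ofReal_add (by positivity) (by positivity), add_halves]
    exact ENNReal.ofReal_le_ofReal (min_le_left _ _)

end Rates

/-! ### The finite sample bound and the rate. -/

theorem theorem4p5
    {Ω Ω' 𝒳 𝒵 HX HZ G : Type*}
    [MeasurableSpace Ω] [MeasurableSpace Ω'] [MeasurableSpace 𝒳] [MeasurableSpace 𝒵]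
    -- the RKHS of real functions on `𝒳`, with kernel `k_X`
    [NormedAddCommGroup HX] [InnerProductSpace ℝ HX] [CompleteSpace HX]
    [TopologicalSpace.SeparableSpace HX] [RKHS ℝ HX 𝒳 ℝ]
    -- the RKHS of real functions on `𝒵`, with kernel `k_Z`
    [NormedAddCommGroup HZ] [InnerProductSpace ℝ HZ] [CompleteSpace HZ]
    [TopologicalSpace.SeparableSpace HZ] [RKHS ℝ HZ 𝒵 ℝ]
    -- the `HX`-valued RKHS on `𝒵`, with kernel `k_Z Id`
    [NormedAddCommGroup G] [InnerProductSpace ℝ G] [CompleteSpace G] [RKHS ℝ G 𝒵 HX]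
    (hG : HasScalarTypeKernel HZ G)
    -- measurable, bounded kernels
    (hXmeas : StronglyMeasurable (fun x : 𝒳 => pointEmbedding HX x))
    (hZmeas : StronglyMeasurable (fun z : 𝒵 => pointEmbedding HZ z))
    (BX BZ : ℝ) (hBX : 0 < BX) (hBZ : 0 < BZ)
    (hkX : ∀ x : 𝒳, scalarKernel HX x x ≤ BX ^ 2)
    (hkZ : ∀ z : 𝒵, scalarKernel HZ z z ≤ BZ ^ 2)
    -- the random variables `X` and `Z`
    (P : Measure Ω) [IsProbabilityMeasure P]
    (X : Ω → 𝒳) (Z : Ω → 𝒵) (hX : Measurable X) (hZ : Measurable Z)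
    -- the true function, which belongs to `G`
    (F : 𝒵 → HX) (hF : IsConditionalMeanFunction P X Z F)
    (FG : G) (hFG : ⇑FG = F)
    -- an i.i.d. sequence of samples from the law of `(X, Z)`
    (Q : Measure Ω') [IsProbabilityMeasure Q]
    (S : ℕ → Ω' → 𝒳 × 𝒵) (hS : ∀ i, Measurable (S i)) (hindep : iIndepFun S Q)
    (hlaw : ∀ i, Q.map (S i) = P.map (fun ω => (X ω, Z ω))) :
    (∀ n : ℕ, 1 ≤ n → ∀ lam : ℝ, 0 < lam → ∀ δ : ℝ, 0 < δ → δ < 1 →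
      Q {ω' | ¬ (surrogateRisk P X Z (cmeEstimator HZ G lam (fun i : Fin n => S i ω'))
            - surrogateRisk P X Z F
          ≤ lam * ‖FG‖ ^ 2
            + 2 * Real.log (4 / δ) / (3 * n * lam)
              * (1 + Real.sqrt (1 + 18 * n / Real.log (4 / δ)))
              * ((BZ * ‖FG‖ + BX) ^ 2 * lam + BX ^ 2 * (BZ + Real.sqrt lam) ^ 2))}
        ≤ ENNReal.ofReal δ) ∧
    (∀ lam : ℕ → ℝ, (∀ n, 1 ≤ n → 0 < lam n) → Tendsto lam atTop (𝓝 0) →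
      (fun n : ℕ => (n : ℝ) ^ (-(1 / 2) : ℝ)) =o[atTop] lam →
      lam =O[atTop] (fun n : ℕ => (n : ℝ) ^ (-(1 / 4) : ℝ)) →
      IsBigOInProbability Q
        (fun n ω' => surrogateRisk P X Z (cmeEstimator HZ G (lam n) (fun i : Fin n => S i ω'))
          - surrogateRisk P X Z F)
        (fun n : ℕ => (n : ℝ) ^ (-(1 / 4) : ℝ))) := by
  have hμP : IsProbabilityMeasure (P.map fun ω => (X ω, Z ω)) :=
    Measure.isProbabilityMeasure_map (hX.prodMk hZ).aemeasurable
  subst hFG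
  have hFC : ∀ z, ‖FG z‖ ≤ BZ * ‖FG‖ := hG.norm_apply_le hBZ.le hkZ FG
  have hest : ∀ (n : ℕ) (lam : ℝ) (D : Fin n → 𝒳 × 𝒵),
      StronglyMeasurable ⇑(cmeEstimator HZ G lam D) := fun n lam D =>
    stronglyMeasurable_sum_kerFun hG hZmeas Finset.univ (fun i => (D i).2) _
  refine ⟨fun n hn lam hlam δ hδ0 hδ1 => ?_, fun lam hlam _ hlo hO => ?_⟩
  · simp only [surrogateRisk_eq_integral_map hXmeas hX hZ (hest _ _ _),
      surrogateRisk_eq_integral_map hXmeas hX hZ hF.1]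
    exact measure_risk_cmeEstimator_sub_gt_le hG hXmeas hZmeas hBX hBZ hkX hkZ FG hF.1 hS hindep
      hlaw hn hlam hδ0 hδ1
  · have horth : ∀ h : 𝒵 → HX, StronglyMeasurable h → ∀ K : ℝ, (∀ z, ‖h z‖ ≤ K) →
        ∫ s, inner ℝ (h s.2) (pointEmbedding HX s.1 - FG s.2)
          ∂P.map (fun ω => (X ω, Z ω)) = 0 := fun h hh K hhK =>
      hF.integral_inner_residual_eq_zero hXmeas hBX.le hkX hX hZ hFC hh hhK
    -- Only the rate needs this identity, and with it the conditional mean property of `FG`.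
    have hexcess : ∀ (n : ℕ) (l : ℝ) (D : Fin n → 𝒳 × 𝒵),
        surrogateRisk P X Z (cmeEstimator HZ G l D) - surrogateRisk P X Z FG
          = ∫ s, ‖(cmeEstimator HZ G l D - FG) s.2‖ ^ 2 ∂P.map (fun ω => (X ω, Z ω)) := by
      intro n l D
      have hD : ∀ z, ‖cmeEstimator HZ G l D z‖ ≤ BZ * ‖cmeEstimator HZ G l D‖ :=
        hG.norm_apply_le hBZ.le hkZ _
      rw [surrogateRisk_eq_integral_map hXmeas hX hZ (hest _ _ _),
        surrogateRisk_eq_integral_map hXmeas hX hZ hF.1,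
        integral_norm_sq_residual_sub_eq hXmeas hBX.le hkX hF.1 hFC (hest _ _ _) hD horth]
      simp only [RKHS.coe_sub, Pi.sub_apply]
    simp only [hexcess]
    exact isBigOInProbability_integral_norm_sq_cmeEstimator_sub hG hXmeas hZmeas hBX hBZ hkX hkZ FG
      hF.1 hS hindep hlaw horth hlam hlo hO
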